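/- **Setting.** Let $(\Omega,\mathcal F,\mathbb P)$ be a probability space and $(\tau_x)_{x\in\mathbb R}$ a one-parameter group of measurable transformations of $\Omega$ ($\tau_0=\mathrm{id}$, $\tau_{x+y}=\tau_x\circ\tau_y$) that preserve $\mathbb P$, with ergodic action: every measurable $\varphi:\Omega\to\mathbb R$ with $\varphi\circ\tau_x=\varphi$ a.s. for each fixed $x$ is a.s. constant. A function $f:\mathbb R\times\Omega\to\mathbb R$ is called stationary if it is jointly measurable and $f(x+y,\omega)=f(x,\tau_y\omega)$ for all $x,y,\omega$. Let $\kappa,\alpha_0,\alpha_1>0$ and $\gamma>2$. Let $a:\mathbb R\times\Omega\to[0,1]$ be stationary, with $a(\cdot,\omega)>0$ on $\mathbb R$ for a.e. $\omega$ and $\sqrt{a(\cdot,\omega)}$ $\kappa$-Lipschitz for every $\omega$. Let $H:\mathbb R\times\mathbb R\times\Omega\to\mathbb R$ be jointly measurable, with $H(x+y,p,\omega)=H(x,p,\tau_y\omega)$ and, for all $x,y,p,q,\omega$, - $\alpha_0|p|^\gamma-1/\alpha_0\le H(x,p,\omega)\le\alpha_1(|p|^\gamma+1)$, - $|H(x,p,\omega)-H(x,q,\omega)|\le\alpha_1(|p|+|q|+1)^{\gamma-1}|p-q|$,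 - $|H(x,p,\omega)-H(y,p,\omega)|\le\alpha_1(|p|^\gamma+1)|x-y|$. For $\omega\in\Omega$ let $\lambda_0(\omega)$ be the infimum of the $\lambda\in\mathbb R$ for which the equation $a(x,\omega)u''+H(x,u',\omega)=\lambda$ in $\mathbb R$ has a continuous viscosity supersolution, i.e. a continuous $u:\mathbb R\to\mathbb R$ such that $a(x_0,\omega)\varphi''(x_0)+H(x_0,\varphi'(x_0),\omega)\le\lambda$ whenever $\varphi\in C^2(\mathbb R)$ and $u-\varphi$ has a local minimum at $x_0$. For $\lambda\in\mathbb R$ let $\mathcal S_\lambda$ be the set of essentially bounded stationary functions $f:\mathbb R\times\Omega\to\mathbb R$ such that, for a.e. $\omega$, $f(\cdot,\omega)$ is a $C^1$ solution of $$a(x,\omega)f'+H(x,f,\omega)=\lambda\quad\text{in }\mathbb R,$$ and put $\Theta(\lambda):=\{\mathbb E[f(0,\cdot)] : f\in\mathcal S_\lambda\}$. **Proposition 5.1.** The random variable $\lambda_0(\omega)$ is a.s. equal to a constant $\lambda_0\in\mathbb R$, and the set-valued map $\Theta$ on $[\lambda_0,+\infty)$ has the following properties. 1. $\Theta(\lambda)$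 is a nonempty compact set for every $\lambda\ge\lambda_0$. 2. $\Theta$ is locally equi-compact: $\bigcup_{\lambda\in K}\Theta(\lambda)$ is compact for every compact $K\subset[\lambda_0,+\infty)$. 3. $\Theta$ is upper semicontinuous: for every $\lambda\ge\lambda_0$ and every open $U\supset\Theta(\lambda)$ one has $\Theta(\mu)\subset U$ for all $\mu\ge\lambda_0$ close enough to $\lambda$. Also, if $\lambda_n\to\lambda$ in $[\lambda_0,+\infty)$, $\theta_n\in\Theta(\lambda_n)$ and $\theta_n\to\theta$, then $\theta\in\Theta(\lambda)$. 4. $\Theta(\lambda_1)\cap\Theta(\lambda_2)=\emptyset$ for all $\lambda_1\ne\lambda_2$ in $[\lambda_0,+\infty)$. 5. $\displaystyle\lim_{\lambda\to+\infty}\max\Theta(\lambda)=+\infty$ and $\displaystyle\lim_{\lambda\to+\infty}\min\Theta(\lambda)=-\infty$. -/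

import Mathlib

open Set Filter Topology MeasureTheory

/-- `τ` is a one-parameter group of measurable, `P`-preserving transformations of `Ω` whose
action is ergodic: every measurable `φ : Ω → ℝ` such that, for each fixed `x`,
`φ ∘ τ x = φ` almost surely, is almost surely constant. -/
structure IsErgodicAction {Ω : Type*} [MeasurableSpace Ω] (P : Measure Ω)
    (τ : ℝ → Ω → Ω) : Prop where
  zero : ∀ ω, τ 0 ω = ω
  add : ∀ x y ω, τ (x + y) ω = τ x (τ y ω)
  preserving : ∀ x, MeasurePreserving (τ x) P P
  ergodic : ∀ φ : Ω → ℝ, Measurable φ → (∀ x, ∀ᵐ ω ∂P, φ (τ x ω) = φ ω) →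
    ∃ c : ℝ, ∀ᵐ ω ∂P, φ ω = c

/-- A random function `f(x, ω)` is stationary if it is jointly measurable and
`f(x + y, ω) = f(x, τ_y ω)` for all `x`, `y`, `ω`. -/
structure IsStationaryFun {Ω : Type*} [MeasurableSpace Ω] (τ : ℝ → Ω → Ω)
    (f : ℝ → Ω → ℝ) : Prop where
  measurable : Measurable fun z : ℝ × Ω => f z.1 z.2
  shift : ∀ x y ω, f (x + y) ω = f x (τ y ω)

/-- Assumptions on the diffusion coefficient: `a : ℝ × Ω → [0, 1]` is stationary, almost surely
strictly positive on the whole line, and `√a(·, ω)` is `κ`-Lipschitz for every `ω`. -/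
structure IsDiffusionCoeff {Ω : Type*} [MeasurableSpace Ω] (P : Measure Ω) (τ : ℝ → Ω → Ω)
    (κ : ℝ) (a : ℝ → Ω → ℝ) : Prop where
  stationary : IsStationaryFun τ a
  mem_Icc : ∀ x ω, a x ω ∈ Set.Icc (0 : ℝ) 1
  pos : ∀ᵐ ω ∂P, ∀ x, 0 < a x ω
  sqrt_lipschitz : ∀ ω x y, |√(a x ω) - √(a y ω)| ≤ κ * |x - y|

/-- The class of Hamiltonians `H(x, p, ω)` with parameters `α₀`, `α₁`, `γ`. -/
structure IsHamiltonian {Ω : Type*} (α₀ α₁ γ : ℝ) (H : ℝ → ℝ → Ω → ℝ) : Prop where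
  lower : ∀ x p ω, α₀ * |p| ^ γ - 1 / α₀ ≤ H x p ω
  upper : ∀ x p ω, H x p ω ≤ α₁ * (|p| ^ γ + 1)
  lipschitz_p : ∀ x p q ω,
    |H x p ω - H x q ω| ≤ α₁ * (|p| + |q| + 1) ^ (γ - 1) * |p - q|
  lipschitz_x : ∀ x y p ω, |H x p ω - H y p ω| ≤ α₁ * (|p| ^ γ + 1) * |x - y|

/-- The Hamiltonian is jointly measurable and stationary with respect to shifts in `x`. -/
structure IsStationaryHamiltonian {Ω : Type*} [MeasurableSpace Ω] (τ : ℝ → Ω → Ω)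
    (H : ℝ → ℝ → Ω → ℝ) : Prop where
  measurable : Measurable fun z : ℝ × ℝ × Ω => H z.1 z.2.1 z.2.2
  shift : ∀ x y p ω, H (x + y) p ω = H x p (τ y ω)

/-- `u` is a continuous viscosity supersolution on `ℝ` of the deterministic equation
`b(x) u'' + G(x, u') = lam`. Since the second order term has a plus sign, this means that
`b(x₀) φ''(x₀) + G(x₀, φ'(x₀)) ≤ lam` whenever a `C²` function `φ` touches `u` from below
at `x₀`, that is, whenever `u - φ` has a local minimum at `x₀`. -/
def IsViscositySupersolution (b : ℝ → ℝ) (G : ℝ → ℝ → ℝ) (lam : ℝ) (u : ℝ → ℝ) : Prop :=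
  Continuous u ∧ ∀ φ : ℝ → ℝ, ContDiff ℝ 2 φ → ∀ x₀ : ℝ,
    IsLocalMin (fun x => u x - φ x) x₀ →
      b x₀ * deriv (deriv φ) x₀ + G x₀ (deriv φ x₀) ≤ lam

/-- The levels `lam` at which `b(x) u'' + G(x, u') = lam` has a continuous viscosity
supersolution on `ℝ`. The critical value of the pair `(b, G)` is the infimum of this set. -/
def supersolutionLevels (b : ℝ → ℝ) (G : ℝ → ℝ → ℝ) : Set ℝ :=
  {lam | ∃ u : ℝ → ℝ, IsViscositySupersolution b G lam u}

/-- `f` is a `C¹` solution on `ℝ` of `b(x) f' + G(x, f) = lam`. -/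
def IsODESolution (b : ℝ → ℝ) (G : ℝ → ℝ → ℝ) (lam : ℝ) (f : ℝ → ℝ) : Prop :=
  ContDiff ℝ 1 f ∧ ∀ x, b x * deriv f x + G x (f x) = lam

/-- The stationary, essentially bounded random functions `f(x, ω)` such that `f(·, ω)` is,
almost surely, a `C¹` solution of `a(x, ω) f' + H(x, f, ω) = lam`. As `f(·, ω)` is almost surely
continuous, essential boundedness on `ℝ × Ω` amounts to a deterministic bound on `|f(·, ω)|`
over the whole line, for almost every `ω`. -/
def stationarySolutions {Ω : Type*} [MeasurableSpace Ω] (P : Measure Ω) (τ : ℝ → Ω → Ω)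
    (a : ℝ → Ω → ℝ) (H : ℝ → ℝ → Ω → ℝ) (lam : ℝ) : Set (ℝ → Ω → ℝ) :=
  {f | IsStationaryFun τ f ∧ (∃ C : ℝ, ∀ᵐ ω ∂P, ∀ x, |f x ω| ≤ C) ∧
    ∀ᵐ ω ∂P, IsODESolution (fun x => a x ω) (fun x p => H x p ω) lam (fun x => f x ω)}

/-- The set-valued map `Θ(lam) = {E[f(0, ·)] : f a stationary solution at level lam}`. -/
noncomputable def thetaMap {Ω : Type*} [MeasurableSpace Ω] (P : Measure Ω) (τ : ℝ → Ω → Ω)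
    (a : ℝ → Ω → ℝ) (H : ℝ → ℝ → Ω → ℝ) (lam : ℝ) : Set ℝ :=
  {θ | ∃ f ∈ stationarySolutions P τ a H lam, θ = ∫ ω, f 0 ω ∂P}

/-- A set-valued map is locally equi-compact on `s` if the union of its values over every compact
subset of `s` is compact. -/
def LocallyEquiCompactOn (Θ : ℝ → Set ℝ) (s : Set ℝ) : Prop :=
  ∀ K : Set ℝ, K ⊆ s → IsCompact K → IsCompact (⋃ l ∈ K, Θ l)

/-- Sequential closedness of the graph of a set-valued map over `s`. -/
def HasSeqClosedGraphOn (Θ : ℝ → Set ℝ) (s : Set ℝ) : Prop :=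
  ∀ (l : ℕ → ℝ) (t : ℕ → ℝ) (l₀ t₀ : ℝ), (∀ n, l n ∈ s) → l₀ ∈ s → (∀ n, t n ∈ Θ (l n)) →
    Tendsto l atTop (𝓝 l₀) → Tendsto t atTop (𝓝 t₀) → t₀ ∈ Θ l₀

/-! The equation is a scalar ODE, so comparison orders its solutions, and everything rests on this
order. Truncate the slope field at height `N` and start from the value `N` at a point `s`. As `s`
decreases to `-∞` these solutions decrease. If they never fall below `-N`, their limit `maxSol` is
the maximal solution on the line. It is given by explicit limits (Picard iterates, then a limsup),
hence it is jointly measurable and stationary.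

Survival above `-N` is tied to the critical value. Coercivity makes every viscosity supersolution
Lipschitz, by comparison with logarithmic barriers (`IsViscositySupersolution.le_add_mul`). If a
truncated solution fell from `N` to `-N`, its primitive would touch a supersolution of a lower level
from below, which is impossible (`neg_le_startedSol_of_supersolution`). Conversely, the primitive of
a solution is a supersolution. So the critical value is the infimum of the solvable levels.
Solvability at a fixed level obeys a zero-one law, which makes this infimum deterministic, and a
monotone limit of maximal solutions shows that it is attained.

By comparison the event `f(0) ≤ g(0)` is invariant under forward shifts when the level of `f` is at
most that of `g`. Ergodicity therefore makes any two stationary solutions almost surely ordered. Two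
consequences follow. Equal means force equal solutions, hence equal levels
(`level_eq_of_mem_thetaMap`). Any sequence of stationary solutions at bounded levels has a monotone
subsequence, which converges pointwise; this closes the graph of `Θ` (`mem_thetaMap_of_tendsto`)
and, with the a priori bound `slopeBound`, gives compactness and upper semicontinuity. Large
constants are lower barriers at high levels, so `max Θ` tends to `+∞`; the reflection `(x, p) ↦ (-x,
-p)` gives `min Θ`. -/

/-! ### Scalar initial value problems: comparison and Picard iteration -/

/-- A function that starts nonpositive and satisfies `d' ≤ L d` wherever it is positive stays
nonpositive. -/
theorem nonpos_of_deriv_le_mul_self {d d' : ℝ → ℝ} {L s t : ℝ} (hst : s ≤ t)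
    (hc : ContinuousOn d (Icc s t)) (hd : ∀ x ∈ Ioo s t, HasDerivAt d (d' x) x)
    (h0 : d s ≤ 0) (hL : ∀ x ∈ Ioo s t, 0 < d x → d' x ≤ L * d x) : d t ≤ 0 := by
  by_contra! hpos
  have hK : IsCompact (Icc s t ∩ d ⁻¹' Iic 0) :=
    isCompact_Icc.of_isClosed_subset (hc.preimage_isClosed_of_isClosed isClosed_Icc isClosed_Iic)
      inter_subset_left
  -- `z` is the last point with `d ≤ 0`. After it `d` is positive, so `d * exp (-L x)` is
  -- nonincreasing and cannot become positive.
  obtain ⟨z, ⟨⟨hz, hdz⟩, hmax⟩⟩ := hK.exists_isGreatest ⟨s, ⟨left_mem_Icc.2 hst, h0⟩⟩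
  have hzt : z ≤ t := hz.2
  have hpos' : ∀ x ∈ Ioc z t, 0 < d x := by
    intro x hx
    by_contra! hx0
    exact absurd (hmax ⟨⟨hz.1.trans hx.1.le, hx.2⟩, hx0⟩) (not_le.2 hx.1)
  have hsub : Ioo z t ⊆ Ioo s t := Ioo_subset_Ioo_left hz.1
  have hder : ∀ x ∈ Ioo z t, HasDerivAt (fun x => d x * Real.exp (-L * x))
      (d' x * Real.exp (-L * x) + d x * (Real.exp (-L * x) * (-L))) x := by
    intro x hx
    have h1 : HasDerivAt (fun x : ℝ => Real.exp (-L * x)) (Real.exp (-L * x) * (-L)) x := by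
      simpa using ((hasDerivAt_id x).const_mul (-L)).exp
    exact (hd x (hsub hx)).mul h1
  have hanti : AntitoneOn (fun x => d x * Real.exp (-L * x)) (Icc z t) := by
    apply antitoneOn_of_deriv_nonpos (convex_Icc z t)
    · exact (hc.mono (Icc_subset_Icc_left hz.1)).mul (by fun_prop)
    · rw [interior_Icc]
      exact fun x hx => (hder x hx).differentiableAt.differentiableWithinAt
    · rw [interior_Icc]
      intro x hx
      rw [(hder x hx).deriv]
      have := hL x (hsub hx) (hpos' x ⟨hx.1, hx.2.le⟩)
      have he := Real.exp_pos (-L * x)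
      nlinarith
  have h1 := hanti (left_mem_Icc.2 hzt) (right_mem_Icc.2 hzt) hzt
  have h2 : d z * Real.exp (-L * z) ≤ 0 := mul_nonpos_of_nonpos_of_nonneg hdz (Real.exp_pos _).le
  have h3 : 0 < d t * Real.exp (-L * t) := mul_pos hpos (Real.exp_pos _)
  simp only at h1
  linarith

/-- The Picard iterates of the initial value problem `g' = v(t, g)`, `g(0) = p₀`. -/
noncomputable def picardIter (v : ℝ → ℝ → ℝ) (p₀ : ℝ) : ℕ → ℝ → ℝ
  | 0 => fun _ => p₀
  | k + 1 => fun t => p₀ + ∫ r in (0 : ℝ)..t, v r (picardIter v p₀ k r)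

/-- The upper limit of the Picard iterates of `g' = v(t, g)`, `g(0) = p₀`. -/
noncomputable def picardFlow (v : ℝ → ℝ → ℝ) (p₀ t : ℝ) : ℝ :=
  limsup (fun k => picardIter v p₀ k t) atTop

theorem continuous_picardIter {v : ℝ → ℝ → ℝ} (hv : Continuous (Function.uncurry v)) (p₀ : ℝ)
    (k : ℕ) : Continuous (picardIter v p₀ k) := by
  induction k with
  | zero => exact continuous_const
  | succ k ih =>
    have : Continuous fun r => v r (picardIter v p₀ k r) := hv.comp (continuous_id.prodMk ih)
    exact continuous_const.add
      (intervalIntegral.continuous_primitive (fun a b => this.intervalIntegrable a b) 0)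

/-- Iterating the Lipschitz bound integrates powers of `t` and produces the factorial. This
identifies the limsup in `picardFlow` with any solution `g` obtained by other means. -/
theorem abs_picardIter_sub_le {v : ℝ → ℝ → ℝ} (hv : Continuous (Function.uncurry v)) {p₀ T L D : ℝ}
    (hL : 0 ≤ L) (hlip : ∀ t ∈ Icc 0 T, ∀ p q, |v t p - v t q| ≤ L * |p - q|) {g : ℝ → ℝ}
    (hg : ContinuousOn g (Icc 0 T))
    (hgi : ∀ t ∈ Icc 0 T, g t = p₀ + ∫ r in (0 : ℝ)..t, v r (g r))
    (hD : ∀ t ∈ Icc 0 T, |p₀ - g t| ≤ D) (k : ℕ) :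
    ∀ t ∈ Icc 0 T, |picardIter v p₀ k t - g t| ≤ D * ((L * t) ^ k / k.factorial) := by
  induction k with
  | zero => intro t ht; simpa [picardIter] using hD t ht
  | succ k ih =>
    intro t ht
    have hsub : Icc 0 t ⊆ Icc 0 T := Icc_subset_Icc_right ht.2
    have hi1 : IntervalIntegrable (fun r => v r (picardIter v p₀ k r)) volume 0 t :=
      (hv.comp (continuous_id.prodMk (continuous_picardIter hv p₀ k))).intervalIntegrable 0 t
    have hi2 : IntervalIntegrable (fun r => v r (g r)) volume 0 t := by
      apply ContinuousOn.intervalIntegrable_of_Icc ht.1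
      exact hv.comp_continuousOn (continuousOn_id.prodMk (hg.mono hsub))
    have e : picardIter v p₀ (k + 1) t - g t
        = ∫ r in (0 : ℝ)..t, (v r (picardIter v p₀ k r) - v r (g r)) := by
      rw [intervalIntegral.integral_sub hi1 hi2, hgi t ht, picardIter]
      ring
    rw [e]
    have hb : ∀ r ∈ Ioc 0 t, ‖v r (picardIter v p₀ k r) - v r (g r)‖
        ≤ (L * D * L ^ k / k.factorial) * r ^ k := by
      intro r hr
      have hr' : r ∈ Icc 0 T := hsub ⟨hr.1.le, hr.2⟩
      rw [Real.norm_eq_abs]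
      calc _ ≤ L * |picardIter v p₀ k r - g r| := hlip r hr' _ _
        _ ≤ L * (D * ((L * r) ^ k / k.factorial)) := by gcongr; exact ih r hr'
        _ = _ := by rw [mul_pow]; ring
    have := intervalIntegral.norm_integral_le_of_norm_le (μ := volume) ht.1
      (Eventually.of_forall hb) ((continuous_const.mul (continuous_pow k)).intervalIntegrable 0 t)
    rw [Real.norm_eq_abs] at this
    refine this.trans (le_of_eq ?_)
    rw [intervalIntegral.integral_const_mul, integral_pow, Nat.factorial_succ]
    push_cast
    have hk : (k.factorial : ℝ) ≠ 0 := by positivity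
    have hk1 : (k : ℝ) + 1 ≠ 0 := by positivity
    field_simp
    ring

/-- The limit of the Picard iterates solves the initial value problem forward in time when the
vector field is bounded and Lipschitz in the state, locally uniformly in time. -/
theorem picardFlow_spec {v : ℝ → ℝ → ℝ} (hv : Continuous (Function.uncurry v)) (p₀ : ℝ)
    (hlip : ∀ T, ∃ L, 0 ≤ L ∧ ∀ t ∈ Icc 0 T, ∀ p q, |v t p - v t q| ≤ L * |p - q|)
    (hbdd : ∀ T, ∃ M, ∀ t ∈ Icc 0 T, ∀ p, |v t p| ≤ M) :
    picardFlow v p₀ 0 = p₀ ∧ ContinuousOn (picardFlow v p₀) (Ici 0) ∧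
      ∀ t, 0 < t → HasDerivAt (picardFlow v p₀) (v t (picardFlow v p₀ t)) t := by
  have key : ∀ T, 0 < T → ∃ g : ℝ → ℝ, g 0 = p₀ ∧ ContinuousOn g (Icc 0 T) ∧
      (∀ t ∈ Ioo 0 T, HasDerivAt g (v t (g t)) t) ∧ EqOn (picardFlow v p₀) g (Icc 0 T) := by
    intro T hT
    obtain ⟨L, hL, hL'⟩ := hlip T
    obtain ⟨M, hM'⟩ := hbdd T
    have hM : 0 ≤ M := (abs_nonneg _).trans (hM' 0 ⟨le_rfl, hT.le⟩ 0)
    -- A field bounded by `M` moves the state by at most `M * T` on `[0, T]`, so this radius gives a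
    -- solution on the whole interval.
    have hPL : IsPicardLindelof v (⟨0, ⟨le_rfl, hT.le⟩⟩ : Icc (0 : ℝ) T) p₀
        (⟨M * T, by positivity⟩ : NNReal) 0 ⟨M, hM⟩ ⟨L, hL⟩ := by
      refine ⟨fun t ht => ?_, fun x _ => ?_, fun t ht x _ => hM' t ht x, ?_⟩
      · apply LipschitzOnWith.of_dist_le_mul
        intro p _ q _
        exact hL' t ht p q
      · exact (hv.comp (continuous_id.prodMk continuous_const)).continuousOn
      · change M * max (T - 0) (0 - 0) ≤ M * T - 0
        simp [hT.le]
    obtain ⟨g, hg0, hg⟩ := hPL.exists_eq_forall_mem_Icc_hasDerivWithinAt₀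
    change g 0 = p₀ at hg0
    have hgc : ContinuousOn g (Icc 0 T) := fun t ht => (hg t ht).continuousWithinAt
    have hgd : ∀ t ∈ Ioo 0 T, HasDerivAt g (v t (g t)) t := fun t ht =>
      (hg t (Ioo_subset_Icc_self ht)).hasDerivAt (Icc_mem_nhds ht.1 ht.2)
    have hgi : ∀ t ∈ Icc 0 T, g t = p₀ + ∫ r in (0 : ℝ)..t, v r (g r) := by
      intro t ht
      have hsub : Icc 0 t ⊆ Icc 0 T := Icc_subset_Icc_right ht.2
      have hi2 : IntervalIntegrable (fun r => v r (g r)) volume 0 t := by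
        apply ContinuousOn.intervalIntegrable_of_Icc ht.1
        exact hv.comp_continuousOn (continuousOn_id.prodMk (hgc.mono hsub))
      rw [intervalIntegral.integral_eq_sub_of_hasDerivAt_of_le ht.1 (hgc.mono hsub)
        (fun r hr => hgd r ⟨hr.1, hr.2.trans_le ht.2⟩) hi2, hg0]
      ring
    obtain ⟨D, hD⟩ := isCompact_Icc.exists_bound_of_continuousOn
      (f := fun t => p₀ - g t) (continuousOn_const.sub hgc)
    refine ⟨g, hg0, hgc, hgd, fun t ht => ?_⟩
    apply Tendsto.limsup_eq
    rw [tendsto_iff_dist_tendsto_zero]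
    refine squeeze_zero (fun _ => dist_nonneg)
      (fun k => abs_picardIter_sub_le hv hL hL' hgc hgi hD k t ht) ?_
    simpa using (FloorSemiring.tendsto_pow_div_factorial_atTop (L * t)).const_mul D
  refine ⟨?_, fun t ht => ?_, fun t ht => ?_⟩
  · obtain ⟨g, h0, -, -, he⟩ := key 1 one_pos
    rw [he ⟨le_rfl, zero_le_one⟩, h0]
  · have ht : 0 ≤ t := ht
    obtain ⟨g, -, hc, -, he⟩ := key (t + 1) (by positivity)
    have h1 : ContinuousWithinAt (picardFlow v p₀) (Icc 0 (t + 1)) t :=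
      (hc.congr he) t ⟨ht, by linarith⟩
    refine h1.mono_of_mem_nhdsWithin ?_
    rw [← Ici_inter_Iic]
    exact inter_mem self_mem_nhdsWithin (mem_nhdsWithin_of_mem_nhds (Iic_mem_nhds (by linarith)))
  · obtain ⟨g, -, -, hd, he⟩ := key (t + 1) (by positivity)
    have hm : t ∈ Ioo 0 (t + 1) := ⟨ht, by linarith⟩
    rw [he (Ioo_subset_Icc_self hm)]
    refine (hd t hm).congr_of_eventuallyEq ?_
    filter_upwards [Icc_mem_nhds hm.1 hm.2] with x hx using he hx

/-! ### Measurability of the Picard flow in a parameter -/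

/-- The moving end point is absorbed into indicators of measurable sets, so that measurability of
integrals depending on a parameter applies. -/
theorem measurable_intervalIntegral_right {Z : Type*} [MeasurableSpace Z] {W : Z → ℝ → ℝ}
    (hW : Measurable fun y : Z × ℝ => W y.1 y.2) :
    Measurable fun y : Z × ℝ => ∫ r in (0 : ℝ)..y.2, W y.1 r := by
  have h : ∀ S : Set ((Z × ℝ) × ℝ), MeasurableSet S →
      Measurable fun y : Z × ℝ => ∫ r, S.indicator (fun w => W w.1.1 w.2) (y, r) := by
    intro S hS
    have h1 : Measurable (S.indicator fun w : (Z × ℝ) × ℝ => W w.1.1 w.2) :=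
      (hW.comp ((measurable_fst.comp measurable_fst).prodMk measurable_snd)).indicator hS
    exact (h1.stronglyMeasurable.integral_prod_right' (ν := volume)).measurable
  have hS1 : MeasurableSet {w : (Z × ℝ) × ℝ | 0 < w.2 ∧ w.2 ≤ w.1.2} :=
    (measurableSet_lt measurable_const measurable_snd).inter
      (measurableSet_le measurable_snd (measurable_snd.comp measurable_fst))
  have hS2 : MeasurableSet {w : (Z × ℝ) × ℝ | w.1.2 < w.2 ∧ w.2 ≤ 0} :=
    (measurableSet_lt (measurable_snd.comp measurable_fst) measurable_snd).inter
      (measurableSet_le measurable_snd measurable_const)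
  convert (h _ hS1).sub (h _ hS2) using 1
  funext y
  rw [Pi.sub_apply]
  rw [intervalIntegral, ← integral_indicator measurableSet_Ioc,
    ← integral_indicator measurableSet_Ioc]
  rfl

theorem measurable_picardIter {Z : Type*} [MeasurableSpace Z] {v : Z → ℝ → ℝ → ℝ}
    (hv : Measurable fun y : Z × ℝ × ℝ => v y.1 y.2.1 y.2.2) (p₀ : ℝ) (k : ℕ) :
    Measurable fun y : Z × ℝ => picardIter (v y.1) p₀ k y.2 := by
  induction k with
  | zero => exact measurable_const
  | succ k ih =>
    have : Measurable fun y : Z × ℝ => v y.1 y.2 (picardIter (v y.1) p₀ k y.2) :=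
      hv.comp (measurable_fst.prodMk (measurable_snd.prodMk ih))
    exact (measurable_intervalIntegral_right
      (W := fun z r => v z r (picardIter (v z) p₀ k r)) this).const_add p₀

/-- This is the reason for defining the flow by a formula rather than choosing a solution for each
parameter. -/
theorem measurable_picardFlow {Z : Type*} [MeasurableSpace Z] {v : Z → ℝ → ℝ → ℝ}
    (hv : Measurable fun y : Z × ℝ × ℝ => v y.1 y.2.1 y.2.2) (p₀ : ℝ) :
    Measurable fun y : Z × ℝ => picardFlow (v y.1) p₀ y.2 :=
  Measurable.limsup fun k => measurable_picardIter hv p₀ k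

/-! ### The truncated equation and the maximal solution on the line -/

/-- Coefficients of the first order equation `b(x) f' + G(x, f) = lam` on the line: `b` is
continuous with values in `(0, 1]`, and `G` is continuous, locally Lipschitz in the second
variable and bounded below by a coercive quadratic polynomial. -/
structure IsCoercivePair (α β : ℝ) (b : ℝ → ℝ) (G : ℝ → ℝ → ℝ) : Prop where
  pos : 0 < α
  continuous_left : Continuous b
  left_pos : ∀ x, 0 < b x
  left_le_one : ∀ x, b x ≤ 1
  continuous_right : Continuous (Function.uncurry G)
  lipschitz : ∀ R, ∃ L, 0 ≤ L ∧ ∀ x p q, |p| ≤ R → |q| ≤ R → |G x p - G x q| ≤ L * |p - q|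
  lower : ∀ x p, α * p ^ 2 - β ≤ G x p

/-- Truncation of a real number to `[-N, N]`. -/
noncomputable def truncate (N p : ℝ) : ℝ := max (-N) (min p N)

theorem continuous_truncate (N : ℝ) : Continuous (truncate N) := by
  unfold truncate; fun_prop

theorem abs_truncate_le {N : ℝ} (hN : 0 ≤ N) (p : ℝ) : |truncate N p| ≤ N :=
  abs_le.2 ⟨le_max_left _ _, max_le (by linarith) (min_le_right _ _)⟩

theorem truncate_eq_self {N p : ℝ} (hp : |p| ≤ N) : truncate N p = p := by
  rw [truncate, min_eq_left (abs_le.1 hp).2, max_eq_right (abs_le.1 hp).1]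

theorem abs_truncate_sub_le (N p q : ℝ) : |truncate N p - truncate N q| ≤ |p - q| := by
  rw [truncate, truncate, max_comm (-N), max_comm (-N)]
  exact (abs_max_sub_max_le_abs _ _ _).trans (by simpa using abs_min_sub_min_le_max p N q N)

/-- The slope field of `b(x) f' + G(x, f) = lam`, truncated at height `N` in the state variable. -/
noncomputable def truncSlope (b : ℝ → ℝ) (G : ℝ → ℝ → ℝ) (lam N x p : ℝ) : ℝ :=
  (lam - G x (truncate N p)) / b x

/-- The solution of the truncated equation that starts from the value `N` at the point `s`. -/
noncomputable def startedSol (b : ℝ → ℝ) (G : ℝ → ℝ → ℝ) (lam N s x : ℝ) : ℝ :=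
  picardFlow (fun r p => truncSlope b G lam N (s + r) p) N (x - s)

/-- The upper limit of the truncated solutions that start from `N` further and further to the
left. It is the maximal solution on the line as soon as there is one. -/
noncomputable def maxSol (b : ℝ → ℝ) (G : ℝ → ℝ → ℝ) (lam N x : ℝ) : ℝ :=
  limsup (fun n : ℕ => startedSol b G lam N (x - n) x) atTop

namespace IsCoercivePair

variable {α β : ℝ} {b : ℝ → ℝ} {G : ℝ → ℝ → ℝ}

theorem exists_bound_inv (h : IsCoercivePair α β b G) (s t : ℝ) :
    ∃ B, 0 ≤ B ∧ ∀ x ∈ Icc s t, 1 / b x ≤ B := by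
  obtain ⟨B, hB⟩ := isCompact_Icc.exists_bound_of_continuousOn (s := Icc s t)
    (f := fun x => 1 / b x)
    (continuous_const.div h.continuous_left fun x => (h.left_pos x).ne').continuousOn
  exact ⟨max B 0, le_max_right _ _, fun x hx =>
    (le_abs_self _).trans ((hB x hx).trans (le_max_left _ _))⟩

theorem continuous_truncSlope (h : IsCoercivePair α β b G) (lam N : ℝ) :
    Continuous fun z : ℝ × ℝ => truncSlope b G lam N z.1 z.2 := by
  have h1 : Continuous fun z : ℝ × ℝ => G z.1 (truncate N z.2) :=
    h.continuous_right.comp (continuous_fst.prodMk ((continuous_truncate N).comp continuous_snd))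
  exact (continuous_const.sub h1).div (h.continuous_left.comp continuous_fst)
    fun z => (h.left_pos z.1).ne'

theorem exists_lipschitz_truncSlope (h : IsCoercivePair α β b G) (lam : ℝ) {N : ℝ} (hN : 0 ≤ N)
    (s t : ℝ) : ∃ L, 0 ≤ L ∧ ∀ x ∈ Icc s t, ∀ p q,
      |truncSlope b G lam N x p - truncSlope b G lam N x q| ≤ L * |p - q| := by
  obtain ⟨B, hB0, hB⟩ := h.exists_bound_inv s t
  obtain ⟨L, hL0, hL⟩ := h.lipschitz N
  refine ⟨L * B, by positivity, fun x hx p q => ?_⟩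
  have hb := h.left_pos x
  have e : truncSlope b G lam N x p - truncSlope b G lam N x q
      = (G x (truncate N q) - G x (truncate N p)) * (1 / b x) := by
    unfold truncSlope; field_simp; ring
  rw [e, abs_mul, abs_of_pos (by positivity : 0 < 1 / b x)]
  have h1 := hL x _ _ (abs_truncate_le hN q) (abs_truncate_le hN p)
  have h2 := abs_truncate_sub_le N q p
  rw [abs_sub_comm q p] at h2
  calc _ ≤ (L * |p - q|) * B := by
        gcongr
        · exact h1.trans (by gcongr)
        · exact hB x hx
    _ = _ := by ring

theorem exists_bound_truncSlope (h : IsCoercivePair α β b G) (lam : ℝ) {N : ℝ} (hN : 0 ≤ N)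
    (s t : ℝ) : ∃ M, ∀ x ∈ Icc s t, ∀ p, |truncSlope b G lam N x p| ≤ M := by
  obtain ⟨M, hM⟩ := (isCompact_Icc (a := s) (b := t)).prod (isCompact_Icc (a := -N) (b := N))
    |>.exists_bound_of_continuousOn (h.continuous_truncSlope lam N).continuousOn
  refine ⟨M, fun x hx p => ?_⟩
  have h1 := abs_truncate_le hN p
  have := hM (x, truncate N p) ⟨hx, abs_le.1 h1⟩
  simpa only [truncSlope, truncate_eq_self h1, Real.norm_eq_abs] using this

theorem startedSol_spec (h : IsCoercivePair α β b G) (lam : ℝ) {N : ℝ} (hN : 0 ≤ N) (s : ℝ) :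
    startedSol b G lam N s s = N ∧ ContinuousOn (startedSol b G lam N s) (Ici s) ∧
      ∀ x, s < x → HasDerivAt (startedSol b G lam N s)
        (truncSlope b G lam N x (startedSol b G lam N s x)) x := by
  obtain ⟨h0, hc, hd⟩ := picardFlow_spec
    (v := fun r p => truncSlope b G lam N (s + r) p)
    ((h.continuous_truncSlope lam N).comp
      (((continuous_const (y := s)).add continuous_fst).prodMk continuous_snd)) N
    (fun T => by
      obtain ⟨L, hL0, hL⟩ := h.exists_lipschitz_truncSlope lam hN s (s + T)
      exact ⟨L, hL0, fun t ht => hL _ ⟨by linarith [ht.1], by linarith [ht.2]⟩⟩)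
    (fun T => by
      obtain ⟨M, hM⟩ := h.exists_bound_truncSlope lam hN s (s + T)
      exact ⟨M, fun t ht => hM _ ⟨by linarith [ht.1], by linarith [ht.2]⟩⟩)
  refine ⟨by simp [startedSol, h0], ?_, fun x hx => ?_⟩
  · exact hc.comp (continuous_id.sub continuous_const).continuousOn
      fun x hx => by simpa using hx
  · have := (hd (x - s) (by linarith)).comp x ((hasDerivAt_id x).sub_const s)
    rw [mul_one, add_sub_cancel] at this
    exact this

/-- Comparison principle for the truncated equation. -/
theorem le_of_subsolution_of_supersolution (h : IsCoercivePair α β b G) {lam N : ℝ} (hN : 0 ≤ N)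
    {f f' g g' : ℝ → ℝ} {s t : ℝ} (hst : s ≤ t)
    (hf : ContinuousOn f (Icc s t)) (hg : ContinuousOn g (Icc s t))
    (hf' : ∀ x ∈ Ioo s t, HasDerivAt f (f' x) x) (hg' : ∀ x ∈ Ioo s t, HasDerivAt g (g' x) x)
    (hfs : ∀ x ∈ Ioo s t, f' x ≤ truncSlope b G lam N x (f x))
    (hgs : ∀ x ∈ Ioo s t, truncSlope b G lam N x (g x) ≤ g' x) (h0 : f s ≤ g s) : f t ≤ g t := by
  obtain ⟨L, hL0, hL⟩ := h.exists_lipschitz_truncSlope lam hN s t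
  have := nonpos_of_deriv_le_mul_self (d := fun x => f x - g x) (d' := fun x => f' x - g' x)
    (L := L) hst (hf.sub hg) (fun x hx => (hf' x hx).sub (hg' x hx)) (by simpa using h0)
    (fun x hx hpos => by
      have h1 := hL x (Ioo_subset_Icc_self hx) (f x) (g x)
      rw [abs_of_pos hpos] at h1
      linarith [hfs x hx, hgs x hx, (abs_le.1 h1).2])
  simpa using this

/-- The constant `N` is a supersolution of the truncated equation. -/
theorem startedSol_le (h : IsCoercivePair α β b G) {lam N s x : ℝ} (hN : 0 ≤ N)
    (hup : ∀ x, lam ≤ G x N) (hsx : s ≤ x) : startedSol b G lam N s x ≤ N := by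
  obtain ⟨h0, hc, hd⟩ := h.startedSol_spec lam hN s
  refine h.le_of_subsolution_of_supersolution hN (g := fun _ => N) (g' := fun _ => 0) hsx
    (hc.mono Icc_subset_Ici_self) continuousOn_const (fun y hy => hd y hy.1)
    (fun y _ => hasDerivAt_const y N) (fun _ _ => le_rfl) (fun y _ => ?_) h0.le
  rw [truncSlope, truncate_eq_self (abs_of_nonneg hN).le]
  exact div_nonpos_of_nonpos_of_nonneg (by linarith [hup y]) (h.left_pos y).le

theorem le_startedSol_of_barrier (h : IsCoercivePair α β b G) {lam N M s x : ℝ} (hM : |M| ≤ N)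
    (hlow : ∀ x, G x M ≤ lam) (hsx : s ≤ x) : M ≤ startedSol b G lam N s x := by
  have hN : 0 ≤ N := (abs_nonneg _).trans hM
  obtain ⟨h0, hc, hd⟩ := h.startedSol_spec lam hN s
  refine h.le_of_subsolution_of_supersolution hN (f := fun _ => M) (f' := fun _ => 0) hsx
    continuousOn_const (hc.mono Icc_subset_Ici_self) (fun y _ => hasDerivAt_const y M)
    (fun y hy => hd y hy.1) (fun y _ => ?_) (fun _ _ => le_rfl)
    (((le_abs_self M).trans hM).trans h0.ge)
  rw [truncSlope, truncate_eq_self hM]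
  exact div_nonneg (by linarith [hlow y]) (h.left_pos y).le

/-- At `s'` the solution with the earlier start has already dropped to at most `N`, the starting
value of the other one; comparison does the rest. -/
theorem startedSol_antitone (h : IsCoercivePair α β b G) {lam N s s' x : ℝ} (hN : 0 ≤ N)
    (hup : ∀ x, lam ≤ G x N) (hs : s ≤ s') (hsx : s' ≤ x) :
    startedSol b G lam N s x ≤ startedSol b G lam N s' x := by
  obtain ⟨h0, hc, hd⟩ := h.startedSol_spec lam hN s
  obtain ⟨h0', hc', hd'⟩ := h.startedSol_spec lam hN s'
  exact h.le_of_subsolution_of_supersolution hN hsx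
    (hc.mono fun y hy => hs.trans hy.1) (hc'.mono Icc_subset_Ici_self)
    (fun y hy => hd y (hs.trans_lt hy.1)) (fun y hy => hd' y hy.1)
    (fun _ _ => le_rfl) (fun _ _ => le_rfl) ((h.startedSol_le hN hup hs).trans h0'.ge)

theorem startedSol_mono_level (h : IsCoercivePair α β b G) {lam mu N s x : ℝ} (hN : 0 ≤ N)
    (hl : lam ≤ mu) (hsx : s ≤ x) :
    startedSol b G lam N s x ≤ startedSol b G mu N s x := by
  obtain ⟨h0, hc, hd⟩ := h.startedSol_spec lam hN s
  obtain ⟨h0', hc', hd'⟩ := h.startedSol_spec mu hN s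
  refine h.le_of_subsolution_of_supersolution hN (lam := lam) hsx
    (hc.mono Icc_subset_Ici_self) (hc'.mono Icc_subset_Ici_self)
    (fun y hy => hd y hy.1) (fun y hy => hd' y hy.1)
    (fun _ _ => le_rfl) (fun y _ => ?_) (h0.trans h0'.symm).le
  exact div_le_div_of_nonneg_right (by linarith) (h.left_pos y).le

theorem isODESolution_iff (h : IsCoercivePair α β b G) {lam : ℝ} {f : ℝ → ℝ} :
    IsODESolution b G lam f ↔ ∀ x, HasDerivAt f ((lam - G x (f x)) / b x) x := by
  constructor
  · rintro ⟨hf, he⟩ x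
    have h1 := ((hf.differentiable one_ne_zero) x).hasDerivAt
    refine h1.congr_deriv ?_
    rw [eq_div_iff (h.left_pos x).ne']
    linarith [he x]
  · intro hd
    have hdiff : Differentiable ℝ f := fun x => (hd x).differentiableAt
    refine ⟨contDiff_one_iff_deriv.2 ⟨hdiff, ?_⟩, fun x => ?_⟩
    · have : deriv f = fun x => (lam - G x (f x)) / b x := funext fun x => (hd x).deriv
      rw [this]
      exact (continuous_const.sub
        (h.continuous_right.comp (continuous_id.prodMk hdiff.continuous))).div h.continuous_left
        fun x => (h.left_pos x).ne'
    · rw [(hd x).deriv, mul_div_cancel₀ _ (h.left_pos x).ne']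
      ring

/-- Two bounded solutions at ordered levels keep their order to the right. -/
theorem le_of_isODESolution (h : IsCoercivePair α β b G) {lam mu N : ℝ} {f g : ℝ → ℝ}
    (hf : IsODESolution b G lam f) (hg : IsODESolution b G mu g) (hfN : ∀ x, |f x| ≤ N)
    (hgN : ∀ x, |g x| ≤ N) (hl : lam ≤ mu) {s t : ℝ} (hst : s ≤ t) (h0 : f s ≤ g s) :
    f t ≤ g t := by
  have hN : 0 ≤ N := (abs_nonneg _).trans (hfN 0)
  refine h.le_of_subsolution_of_supersolution hN (lam := lam) hst
    hf.1.continuous.continuousOn hg.1.continuous.continuousOn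
    (fun x _ => h.isODESolution_iff.1 hf x) (fun x _ => h.isODESolution_iff.1 hg x)
    (fun x _ => ?_) (fun x _ => ?_) h0
  · rw [truncSlope, truncate_eq_self (hfN x)]
  · rw [truncSlope, truncate_eq_self (hgN x)]
    exact div_le_div_of_nonneg_right (by linarith) (h.left_pos x).le

theorem le_startedSol_of_isODESolution (h : IsCoercivePair α β b G) {lam N s x : ℝ} {f : ℝ → ℝ}
    (hf : IsODESolution b G lam f) (hfN : ∀ x, |f x| ≤ N) (hsx : s ≤ x) :
    f x ≤ startedSol b G lam N s x := by
  have hN : 0 ≤ N := (abs_nonneg _).trans (hfN 0)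
  obtain ⟨h0, hc, hd⟩ := h.startedSol_spec lam hN s
  refine h.le_of_subsolution_of_supersolution hN (lam := lam) hsx
    hf.1.continuous.continuousOn (hc.mono Icc_subset_Ici_self)
    (fun x _ => h.isODESolution_iff.1 hf x) (fun y hy => hd y hy.1)
    (fun x _ => ?_) (fun _ _ => le_rfl) (((le_abs_self _).trans (hfN s)).trans h0.ge)
  rw [truncSlope, truncate_eq_self (hfN x)]

/-- Pointwise limits of locally uniformly bounded solutions are solutions. -/
theorem isODESolution_of_tendsto (h : IsCoercivePair α β b G) {l : ℕ → ℝ} {lam N : ℝ}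
    (hN : 0 ≤ N) (hl : Tendsto l atTop (𝓝 lam)) {f : ℕ → ℝ → ℝ} {F : ℝ → ℝ}
    (hf : ∀ R, ∀ᶠ k in atTop, ∀ x ∈ Icc (-R) R,
      |f k x| ≤ N ∧ HasDerivAt (f k) ((l k - G x (f k x)) / b x) x)
    (hF : ∀ x, Tendsto (fun k => f k x) atTop (𝓝 (F x))) : IsODESolution b G lam F := by
  have hlb : ∀ᶠ k in atTop, |l k - lam| ≤ 1 := by
    filter_upwards [Metric.tendsto_nhds.1 hl 1 one_pos] with k hk using hk.le
  -- A uniform bound on the derivatives: it makes the limit locally Lipschitz and dominates the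
  -- integrands when passing to the limit in the integral equation.
  have hbound : ∀ R, ∃ M : ℝ, 0 ≤ M ∧ ∀ᶠ k in atTop, ∀ x ∈ Icc (-R) R,
      |(l k - G x (f k x)) / b x| ≤ M := by
    intro R
    obtain ⟨M, hM⟩ := h.exists_bound_truncSlope lam hN (-R) R
    obtain ⟨B, hB0, hB⟩ := h.exists_bound_inv (-R) R
    refine ⟨|M| + B, by positivity, ?_⟩
    filter_upwards [hlb, hf R] with k hk hfk x hx
    have hb := h.left_pos x
    have e : (l k - G x (f k x)) / b x
        = truncSlope b G lam N x (f k x) + (l k - lam) * (1 / b x) := by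
      rw [truncSlope, truncate_eq_self (hfk x hx).1]
      field_simp; ring
    rw [e]
    refine (abs_add_le _ _).trans (add_le_add ((hM x hx _).trans (le_abs_self M)) ?_)
    rw [abs_mul, abs_of_pos (by positivity : 0 < 1 / b x)]
    calc _ ≤ 1 * B := by gcongr; exact hB x hx
      _ = B := one_mul B
  have hcont : Continuous F := by
    rw [continuous_iff_continuousAt]
    intro y
    obtain ⟨M, hM0, hM⟩ := hbound (|y| + 1)
    have hlip : LipschitzOnWith ⟨M, hM0⟩ F (Icc (-(|y| + 1)) (|y| + 1)) := by
      apply LipschitzOnWith.of_dist_le_mul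
      intro u hu w hw
      refine le_of_tendsto ((hF u).dist (hF w)) ?_
      filter_upwards [hM, hf (|y| + 1)] with k hk hfk
      rw [dist_eq_norm, dist_eq_norm]
      exact (convex_Icc _ _).norm_image_sub_le_of_norm_hasDerivWithin_le
        (fun x hx => (hfk x hx).2.hasDerivWithinAt) (fun x hx => hk x hx) hw hu
    refine hlip.continuousOn.continuousAt (Icc_mem_nhds ?_ ?_)
    · linarith [neg_abs_le y]
    · linarith [le_abs_self y]
  have hcG : ∀ {g : ℝ → ℝ} {c : ℝ} {S : Set ℝ}, ContinuousOn g S →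
      ContinuousOn (fun r => (c - G r (g r)) / b r) S := fun hg =>
    (continuousOn_const.sub (h.continuous_right.comp_continuousOn
      (continuousOn_id.prodMk hg))).div h.continuous_left.continuousOn
      fun x _ => (h.left_pos x).ne'
  have hint : ∀ y, F y = F 0 + ∫ r in (0 : ℝ)..y, (lam - G r (F r)) / b r := by
    intro y
    obtain ⟨M, hM0, hM⟩ := hbound |y|
    have hsub : uIcc 0 y ⊆ Icc (-|y|) |y| := by
      exact uIcc_subset_Icc ⟨by simp, by simp⟩ ⟨neg_abs_le y, le_abs_self y⟩
    have h1 : Tendsto (fun k => ∫ r in (0 : ℝ)..y, (l k - G r (f k r)) / b r) atTop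
        (𝓝 (∫ r in (0 : ℝ)..y, (lam - G r (F r)) / b r)) := by
      apply intervalIntegral.tendsto_integral_filter_of_dominated_convergence (fun _ => M)
      · filter_upwards [hf |y|] with k hk
        refine ContinuousOn.aestronglyMeasurable ?_ measurableSet_uIoc
        exact hcG fun x hx =>
          (hk x (hsub (uIoc_subset_uIcc hx))).2.continuousAt.continuousWithinAt
      · filter_upwards [hM] with k hk
        exact Eventually.of_forall fun x hx => hk x (hsub (uIoc_subset_uIcc hx))
      · simp
      · refine Eventually.of_forall fun x _ => ?_
        have h2 : Tendsto (fun k => G x (f k x)) atTop (𝓝 (G x (F x))) :=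
          ((h.continuous_right.comp (continuous_const.prodMk continuous_id)).tendsto (F x)).comp
            (hF x)
        exact (hl.sub h2).div_const _
    have h2 : Tendsto (fun k => f k y - f k 0) atTop
        (𝓝 (∫ r in (0 : ℝ)..y, (lam - G r (F r)) / b r)) := by
      refine h1.congr' ?_
      filter_upwards [hf |y|] with k hk
      apply intervalIntegral.integral_eq_sub_of_hasDerivAt
      · exact fun x hx => (hk x (hsub hx)).2
      · exact (hcG fun x hx => (hk x (hsub hx)).2.continuousAt.continuousWithinAt).intervalIntegrable
    linarith [tendsto_nhds_unique h2 ((hF y).sub (hF 0))]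
  rw [h.isODESolution_iff]
  intro x
  have hc : Continuous fun r => (lam - G r (F r)) / b r := by
    simpa only [continuousOn_univ] using hcG (c := lam) hcont.continuousOn (S := univ)
  have hd := (intervalIntegral.integral_hasDerivAt_right (hc.intervalIntegrable 0 x)
    (hc.stronglyMeasurableAtFilter _ _) hc.continuousAt).const_add (F 0)
  exact hd.congr_of_eventuallyEq (Eventually.of_forall hint)

/-- Monotone convergence in the starting point. The definition of `maxSol` starts at `x - n`, which
suits stationarity; convergence along every `s → -∞` also allows a start common to all `x`, which is
needed to pass to the limit in the equation. -/
theorem tendsto_startedSol (h : IsCoercivePair α β b G) {lam N : ℝ} (hN : 0 ≤ N)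
    (hup : ∀ x, lam ≤ G x N) (hlow : ∀ s x, s ≤ x → -N ≤ startedSol b G lam N s x) (x : ℝ) :
    Tendsto (fun s => startedSol b G lam N s x) atBot (𝓝 (maxSol b G lam N x)) := by
  -- Monotonicity in `s` is available only for starts to the left of `x`, hence the `min`.
  have h1 : ∃ c, Tendsto (fun s => startedSol b G lam N (min s x) x) atBot (𝓝 c) := by
    refine ⟨_, tendsto_atBot_ciInf (fun s s' hs => ?_) ⟨-N, ?_⟩⟩
    · exact h.startedSol_antitone hN hup (min_le_min_right x hs) (min_le_right _ _)
    · rintro _ ⟨s, rfl⟩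
      exact hlow _ _ (min_le_right _ _)
  obtain ⟨c, hc⟩ := h1
  have h2 : Tendsto (fun s => startedSol b G lam N s x) atBot (𝓝 c) := by
    refine hc.congr' ?_
    filter_upwards [eventually_le_atBot x] with s hs
    rw [min_eq_left hs]
  have h3 : maxSol b G lam N x = c := by
    refine (h2.comp ?_).limsup_eq
    exact tendsto_atBot_add_const_left _ x
      (tendsto_neg_atTop_atBot.comp tendsto_natCast_atTop_atTop)
  rwa [h3]

theorem isODESolution_maxSol (h : IsCoercivePair α β b G) {lam N : ℝ} (hN : 0 ≤ N)
    (hup : ∀ x, lam ≤ G x N) (hlow : ∀ s x, s ≤ x → -N ≤ startedSol b G lam N s x) :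
    IsODESolution b G lam (maxSol b G lam N) := by
  refine h.isODESolution_of_tendsto hN (l := fun _ => lam) tendsto_const_nhds
    (f := fun n => startedSol b G lam N (-(n : ℝ))) (fun R => ?_) (fun x => ?_)
  · filter_upwards [tendsto_natCast_atTop_atTop.eventually_gt_atTop R] with n hn x hx
    have hlt : -(n : ℝ) < x := by linarith [hx.1]
    have hab : |startedSol b G lam N (-(n : ℝ)) x| ≤ N :=
      abs_le.2 ⟨hlow _ _ hlt.le, h.startedSol_le hN hup hlt.le⟩
    refine ⟨hab, ?_⟩
    have := (h.startedSol_spec lam hN (-(n : ℝ))).2.2 x hlt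
    rwa [truncSlope, truncate_eq_self hab] at this
  · exact (h.tendsto_startedSol hN hup hlow x).comp
      (tendsto_neg_atTop_atBot.comp tendsto_natCast_atTop_atTop)

theorem le_maxSol (h : IsCoercivePair α β b G) {lam N M : ℝ} (hN : 0 ≤ N)
    (hup : ∀ x, lam ≤ G x N) (hlow : ∀ s x, s ≤ x → -N ≤ startedSol b G lam N s x) {x : ℝ}
    (hM : ∀ s, s ≤ x → M ≤ startedSol b G lam N s x) : M ≤ maxSol b G lam N x :=
  ge_of_tendsto (h.tendsto_startedSol hN hup hlow x)
    ((eventually_le_atBot x).mono fun s hs => hM s hs)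

theorem maxSol_mono_level (h : IsCoercivePair α β b G) {lam mu N : ℝ} (hN : 0 ≤ N)
    (hl : lam ≤ mu) (hup : ∀ x, mu ≤ G x N)
    (hlow : ∀ s x, s ≤ x → -N ≤ startedSol b G lam N s x) (x : ℝ) :
    maxSol b G lam N x ≤ maxSol b G mu N x :=
  le_of_tendsto_of_tendsto (h.tendsto_startedSol hN (fun y => hl.trans (hup y)) hlow x)
    (h.tendsto_startedSol hN hup
      (fun s y hs => (hlow s y hs).trans (h.startedSol_mono_level hN hl hs)) x)
    ((eventually_le_atBot x).mono fun _ hs => h.startedSol_mono_level hN hl hs)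

end IsCoercivePair

/-! ### Viscosity supersolutions: test functions and slope bounds -/

/-- A viscosity supersolution may be tested with functions that are only twice differentiable
at the contact point. -/
theorem IsViscositySupersolution.le_of_hasDerivAt {b : ℝ → ℝ} {G : ℝ → ℝ → ℝ} {lam : ℝ}
    {u : ℝ → ℝ} (hu : IsViscositySupersolution b G lam u) {φ φ' : ℝ → ℝ} {x₀ s : ℝ}
    (hb : 0 ≤ b x₀) (hφ : ∀ᶠ x in 𝓝 x₀, HasDerivAt φ (φ' x) x) (hφ' : HasDerivAt φ' s x₀)
    (hmin : IsLocalMin (fun x => u x - φ x) x₀) : b x₀ * s + G x₀ (φ' x₀) ≤ lam := by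
  have key : ∀ ε : ℝ, 0 < ε → b x₀ * (s - ε) + G x₀ (φ' x₀) ≤ lam := by
    intro ε hε
    -- The second order Taylor polynomial of `φ` with its second derivative lowered by `ε`. Then `φ
    -- - q` has a local minimum at `x₀`, hence so has `u - q = (u - φ) + (φ - q)`.
    let q : ℝ → ℝ := fun x => φ x₀ + φ' x₀ * (x - x₀) + (s - ε) / 2 * (x - x₀) ^ 2
    have hq : ∀ x, HasDerivAt q (φ' x₀ + (s - ε) * (x - x₀)) x := by
      intro x
      have h1 : HasDerivAt (fun x : ℝ => x - x₀) 1 x := (hasDerivAt_id x).sub_const x₀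
      refine (((h1.const_mul (φ' x₀)).const_add (φ x₀)).add
        ((h1.pow 2).const_mul ((s - ε) / 2))).congr_deriv ?_
      simp; ring
    have hq1 : deriv q = fun x => φ' x₀ + (s - ε) * (x - x₀) := funext fun x => (hq x).deriv
    have hq2 : ∀ x, HasDerivAt (deriv q) (s - ε) x := by
      intro x
      rw [hq1]
      simpa using! (((hasDerivAt_id x).sub_const x₀).const_mul (s - ε)).const_add (φ' x₀)
    have hqc : ContDiff ℝ 2 q := by
      apply ContDiff.add
      · exact contDiff_const.add (contDiff_const.mul (contDiff_id.sub contDiff_const))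
      · exact contDiff_const.mul ((contDiff_id.sub contDiff_const).pow 2)
    have hd : ∀ᶠ x in 𝓝 x₀, deriv (fun x => φ x - q x) x = φ' x - deriv q x := by
      filter_upwards [hφ] with x hx
      rw [hq1]; exact (hx.sub (hq x)).deriv
    have hd2 : HasDerivAt (deriv fun x => φ x - q x) ε x₀ := by
      have := (hφ'.sub (hq2 x₀)).congr_of_eventuallyEq hd
      simpa using! this
    have hloc : IsLocalMin (fun x => φ x - q x) x₀ := by
      apply isLocalMin_of_deriv_deriv_pos
      · rw [hd2.deriv]; exact hε
      · rw [hd.self_of_nhds, hq1]; simp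
      · exact (hφ.self_of_nhds.sub (hq x₀)).continuousAt
    have hmin' : IsLocalMin (fun x => u x - q x) x₀ := by
      filter_upwards [hmin, hloc] with x h1 h2
      linarith
    have := hu.2 q hqc x₀ hmin'
    rw [(hq2 x₀).deriv, hq1] at this
    simpa using this
  refine le_of_forall_pos_le_add fun ε hε => ?_
  have h1 := key (ε / (b x₀ + 1)) (by positivity)
  have h2 : b x₀ * (ε / (b x₀ + 1)) ≤ ε := by
    rw [mul_div_assoc', div_le_iff₀ (by positivity)]
    nlinarith
  linarith

/-- If the minimum of a continuous function over a compact interval is not attained at the end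
points, it is an interior local minimum. -/
theorem exists_isLocalMin_of_lt_endpoints {w : ℝ → ℝ} {s t : ℝ} (hw : ContinuousOn w (Icc s t))
    (hs : ∃ y ∈ Icc s t, w y < w s) (ht : ∃ y ∈ Icc s t, w y < w t) :
    ∃ z ∈ Ioo s t, IsLocalMin w z := by
  obtain ⟨y, hy, hys⟩ := hs
  obtain ⟨y', hy', hyt⟩ := ht
  obtain ⟨z, hz, hmin⟩ := isCompact_Icc.exists_isMinOn ⟨y, hy⟩ hw
  have hzs : z ≠ s := fun e => absurd (hmin hy) (not_le.2 (e ▸ hys))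
  have hzt : z ≠ t := fun e => absurd (hmin hy') (not_le.2 (e ▸ hyt))
  have hz' : z ∈ Ioo s t := ⟨lt_of_le_of_ne hz.1 hzs.symm, lt_of_le_of_ne hz.2 hzt⟩
  exact ⟨z, hz', hmin.isLocalMin (Icc_mem_nhds hz'.1 hz'.2)⟩

/-- The barrier tends to `-∞` at `k / K`, so the difference blows up there, while by `hlt` its value
at `t` is below that at `0`. Its minimum is thus interior. -/
theorem exists_isLocalMin_log_barrier {w : ℝ → ℝ} (hw : Continuous w) {K k t : ℝ} (hK : 0 < K)
    (hk : 0 < k) (ht : 0 ≤ t) (htk : t < k / K) (hlt : w t < w 0 + k * Real.log (1 - K * t / k)) :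
    ∃ z ∈ Ioo 0 (k / K), IsLocalMin (fun r => w r - k * Real.log (1 - K * r / k)) z := by
  have hpos : ∀ r, r < k / K → 0 < 1 - K * r / k := by
    intro r hr
    rw [lt_div_iff₀ hK] at hr
    rw [sub_pos, div_lt_one hk]; linarith
  obtain ⟨m, hm⟩ := (isCompact_Icc (a := (0 : ℝ)) (b := k / K)).exists_bound_of_continuousOn
    hw.continuousOn
  have h1 : Tendsto (fun r => 1 - K * r / k) (𝓝[<] (k / K)) (𝓝[>] 0) := by
    apply tendsto_nhdsWithin_of_tendsto_nhds_of_eventually_within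
    · have : Tendsto (fun r => 1 - K * r / k) (𝓝 (k / K)) (𝓝 (1 - K * (k / K) / k)) :=
        Continuous.tendsto (by fun_prop) _
      have e : 1 - K * (k / K) / k = 0 := by field_simp; ring
      rw [e] at this
      exact this.mono_left nhdsWithin_le_nhds
    · filter_upwards [self_mem_nhdsWithin] with r hr using hpos r hr
  have h2 : Tendsto (fun r => k * Real.log (1 - K * r / k)) (𝓝[<] (k / K)) atBot :=
    (Real.tendsto_log_nhdsGT_zero.comp h1).const_mul_atBot hk
  -- Since `w ≥ -m`, at such an `r` the difference exceeds `w 0`, its value at the left end.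
  obtain ⟨r, hr1, hr3⟩ := ((h2.eventually (eventually_lt_atBot (-m - w 0))).and
    (Ioo_mem_nhdsLT htk)).exists
  have hwr := (abs_le.1 (hm r ⟨ht.trans hr3.1.le, hr3.2.le⟩)).1
  have hcont : ContinuousOn (fun r => w r - k * Real.log (1 - K * r / k)) (Icc 0 r) := by
    apply hw.continuousOn.sub
    apply continuousOn_const.mul
    apply ContinuousOn.log (by fun_prop)
    exact fun y hy => (hpos y (hy.2.trans_lt hr3.2)).ne'
  obtain ⟨z, hz, hzmin⟩ := exists_isLocalMin_of_lt_endpoints hcont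
    ⟨t, ⟨ht, hr3.1.le⟩, by simp only [mul_zero, zero_div, sub_zero, Real.log_one]; linarith⟩
    ⟨0, ⟨le_rfl, ht.trans hr3.1.le⟩, by
      simp only [mul_zero, zero_div, sub_zero, Real.log_one]; linarith⟩
  exact ⟨z, ⟨hz.1, hz.2.trans hr3.2⟩, hzmin⟩

/-- One-sided slope bound for viscosity supersolutions of a quadratically coercive equation. The
sign `σ` selects the direction. -/
theorem IsViscositySupersolution.le_add_mul {b : ℝ → ℝ} {G : ℝ → ℝ → ℝ} {lam K c σ : ℝ}
    {u : ℝ → ℝ} (hu : IsViscositySupersolution b G lam u) (hb0 : ∀ x, 0 ≤ b x)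
    (hb1 : ∀ x, b x ≤ 1) (hK : 0 < K) (hc : 0 < c)
    (hG : ∀ x p, K ≤ |p| → lam + c * p ^ 2 ≤ G x p) (hσ : σ * σ = 1) (x₀ : ℝ) {t : ℝ}
    (ht : 0 ≤ t) : u x₀ ≤ u (x₀ + σ * t) + K * t := by
  -- The barrier satisfies `φ'' = -φ' ^ 2 / k` and `|φ'| ≥ K`. At a contact point `b φ'' + G(φ') ≥
  -- lam + (c - 1/k) φ' ^ 2 > lam`, because `b ≤ 1` and `k > 1 / c`. As `k → ∞` the barrier becomes
  -- the line of slope `-K`.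
  have key : ∀ k, 1 / c < k → t < k / K →
      u x₀ + k * Real.log (1 - K * t / k) ≤ u (x₀ + σ * t) := by
    intro k hkc htk
    have hk : 0 < k := (by positivity : 0 < 1 / c).trans hkc
    by_contra! hlt
    obtain ⟨r, hr, hmin⟩ := exists_isLocalMin_log_barrier (w := fun r => u (x₀ + σ * r))
      (hu.1.comp (by fun_prop)) hK hk ht htk (by simpa using hlt)
    set φ : ℝ → ℝ := fun z => k * Real.log (1 - K * (σ * (z - x₀)) / k) with hφdef
    set z := x₀ + σ * r with hz
    have hσz : σ * (z - x₀) = r := by rw [hz]; linear_combination r * hσ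
    have hmin' : IsLocalMin (fun y => u y - φ y) z := by
      have h1 : Tendsto (fun y => σ * (y - x₀)) (𝓝 z) (𝓝 r) := by
        have : Tendsto (fun y => σ * (y - x₀)) (𝓝 z) (𝓝 (σ * (z - x₀))) :=
          Continuous.tendsto (by fun_prop) z
        rwa [hσz] at this
      filter_upwards [h1.eventually hmin] with y hy
      have e : x₀ + σ * (σ * (y - x₀)) = y := by linear_combination (y - x₀) * hσ
      simp only [e] at hy
      simp only [hφdef, hσz]
      exact hy
    have hDpos : 0 < 1 - K * (σ * (z - x₀)) / k := by
      rw [hσz, sub_pos, div_lt_one hk, mul_comm]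
      exact (lt_div_iff₀ hK).1 hr.2
    have hD' : ∀ y, HasDerivAt (fun y => 1 - K * (σ * (y - x₀)) / k) (-(K * σ / k)) y := by
      intro y
      refine ((((((hasDerivAt_id y).sub_const x₀).const_mul σ).const_mul K).div_const
        k).const_sub 1).congr_deriv ?_
      simp
    have hφ : ∀ᶠ y in 𝓝 z, HasDerivAt φ (-(K * σ) / (1 - K * (σ * (y - x₀)) / k)) y := by
      have hev : ∀ᶠ y in 𝓝 z, 0 < 1 - K * (σ * (y - x₀)) / k :=
        (hD' z).continuousAt.eventually (lt_mem_nhds hDpos)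
      filter_upwards [hev] with y hy
      refine (((hD' y).log hy.ne').const_mul k).congr_deriv ?_
      field_simp
    have hφ' := (hasDerivAt_const z (-(K * σ))).fun_div (hD' z) hDpos.ne'
    have h1 := hu.le_of_hasDerivAt (hb0 z) hφ hφ' hmin'
    rw [hσz] at h1 hDpos
    have hDle : 1 - K * r / k ≤ 1 := by
      have : 0 ≤ K * r / k := by have := hr.1; positivity
      linarith
    set D := 1 - K * r / k with hD
    have hσa : |σ| = 1 := by
      have : |σ| * |σ| = 1 := by rw [← abs_mul, hσ, abs_one]
      nlinarith [abs_nonneg σ]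
    have hp : K ≤ |-(K * σ) / D| := by
      rw [abs_div, abs_neg, abs_mul, hσa, abs_of_pos hK, abs_of_pos hDpos, mul_one,
        le_div_iff₀ hDpos]
      nlinarith
    have h2 := hG z _ hp
    have e1 : (-(K * σ) / D) ^ 2 = K ^ 2 / D ^ 2 := by
      rw [div_pow]; congr 1; linear_combination K ^ 2 * hσ
    have e2 : (0 * D - -(K * σ) * -(K * σ / k)) / D ^ 2 = -(1 / k) * (K ^ 2 / D ^ 2) := by
      field_simp; linear_combination (-K ^ 2) * hσ
    rw [e1] at h2
    rw [e2] at h1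
    have hQ : 0 < K ^ 2 / D ^ 2 := by positivity
    have hkc' : 1 / k < c := by
      rw [div_lt_iff₀ hk]; rw [div_lt_iff₀ hc] at hkc; linarith
    have h3 : b z * (1 / k) ≤ 1 * (1 / k) :=
      mul_le_mul_of_nonneg_right (hb1 z) (by positivity)
    nlinarith
  have hlim : Tendsto (fun k : ℝ => u x₀ + k * Real.log (1 - K * t / k)) atTop
      (𝓝 (u x₀ + -(K * t))) := by
    have := (Real.tendsto_mul_log_one_add_div_atTop (-(K * t))).const_add (u x₀)
    simpa only [neg_div, ← sub_eq_add_neg] using this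
  have := le_of_tendsto hlim (by
    filter_upwards [eventually_gt_atTop (1 / c), eventually_gt_atTop (t * K)] with k h1 h2
    exact key k h1 ((lt_div_iff₀ hK).2 h2))
  linarith

theorem IsViscositySupersolution.abs_sub_le {b : ℝ → ℝ} {G : ℝ → ℝ → ℝ} {lam K c : ℝ}
    {u : ℝ → ℝ} (hu : IsViscositySupersolution b G lam u) (hb0 : ∀ x, 0 ≤ b x)
    (hb1 : ∀ x, b x ≤ 1) (hK : 0 < K) (hc : 0 < c)
    (hG : ∀ x p, K ≤ |p| → lam + c * p ^ 2 ≤ G x p) {x y : ℝ} (hxy : x ≤ y) :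
    |u y - u x| ≤ K * (y - x) := by
  have h1 := hu.le_add_mul hb0 hb1 hK hc hG (σ := 1) (by norm_num) x (sub_nonneg.2 hxy)
  have h2 := hu.le_add_mul hb0 hb1 hK hc hG (σ := -1) (by norm_num) y (sub_nonneg.2 hxy)
  rw [show x + 1 * (y - x) = y by ring] at h1
  rw [show y + -1 * (y - x) = x by ring] at h2
  rw [abs_le]; constructor <;> linarith

/-! ### From solutions to supersolutions and back -/

namespace IsCoercivePair

variable {α β : ℝ} {b : ℝ → ℝ} {G : ℝ → ℝ → ℝ}

/-- A primitive of a solution of the first order equation is a viscosity supersolution of the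
second order equation. -/
theorem isViscositySupersolution_primitive (h : IsCoercivePair α β b G) {lam : ℝ} {f : ℝ → ℝ}
    (hf : IsODESolution b G lam f) :
    IsViscositySupersolution b G lam (fun x => ∫ r in (0 : ℝ)..x, f r) := by
  have hd : ∀ x, HasDerivAt (fun x => ∫ r in (0 : ℝ)..x, f r) (f x) x := fun x =>
    intervalIntegral.integral_hasDerivAt_right (hf.1.continuous.intervalIntegrable 0 x)
      (hf.1.continuous.stronglyMeasurableAtFilter _ _) hf.1.continuous.continuousAt
  refine ⟨continuous_iff_continuousAt.2 fun x => (hd x).continuousAt, fun φ hφ x₀ hmin => ?_⟩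
  have hφ1 : Differentiable ℝ φ := hφ.differentiable two_ne_zero
  have hφ2 : Differentiable ℝ (deriv φ) :=
    (contDiff_succ_iff_deriv (n := 1) (f := φ) |>.1 (by simpa [one_add_one_eq_two] using hφ)).2.2
      |>.differentiable one_ne_zero
  have hw : ∀ x, HasDerivAt (fun x => (∫ r in (0 : ℝ)..x, f r) - φ x) (f x - deriv φ x) x :=
    fun x => (hd x).sub (hφ1 x).hasDerivAt
  have h0 : f x₀ - deriv φ x₀ = 0 := hmin.hasDerivAt_eq_zero (hw x₀)
  have hw2 : HasDerivAt (fun x => f x - deriv φ x)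
      ((lam - G x₀ (f x₀)) / b x₀ - deriv (deriv φ) x₀) x₀ :=
    (h.isODESolution_iff.1 hf x₀).sub (hφ2 x₀).hasDerivAt
  have h2 : 0 ≤ (lam - G x₀ (f x₀)) / b x₀ - deriv (deriv φ) x₀ := by
    -- With a negative second derivative `x₀` would also be a local maximum, so the difference would
    -- be locally constant and its second derivative zero.
    by_contra! hneg
    have hder : deriv (fun x => (∫ r in (0 : ℝ)..x, f r) - φ x) = fun x => f x - deriv φ x :=
      funext fun x => (hw x).deriv
    have hmax : IsLocalMax (fun x => (∫ r in (0 : ℝ)..x, f r) - φ x) x₀ := by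
      apply isLocalMax_of_deriv_deriv_neg
      · rw [hder, hw2.deriv]; exact hneg
      · rw [hder]; exact h0
      · exact (hw x₀).continuousAt
    have hconst : (fun x => (∫ r in (0 : ℝ)..x, f r) - φ x)
        =ᶠ[𝓝 x₀] fun _ => (∫ r in (0 : ℝ)..x₀, f r) - φ x₀ := by
      filter_upwards [hmin, hmax] with x h1 h2 using le_antisymm h2 h1
    have hz := hconst.deriv.deriv_eq
    rw [hder, hw2.deriv, deriv_const', deriv_const] at hz
    exact hneg.ne hz
  have hb := h.left_pos x₀
  rw [sub_nonneg, le_div_iff₀ hb] at h2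
  rw [← sub_eq_zero.1 h0]
  linarith

/-- The solution is the slope of its primitive, a supersolution and hence `K`-Lipschitz. No prior
bound on `f` is needed. -/
theorem abs_le_of_isODESolution (h : IsCoercivePair α β b G) {lam K c : ℝ} (hK : 0 < K)
    (hc : 0 < c) (hG : ∀ x p, K ≤ |p| → lam + c * p ^ 2 ≤ G x p) {f : ℝ → ℝ}
    (hf : IsODESolution b G lam f) (x : ℝ) : |f x| ≤ K := by
  have hu := h.isViscositySupersolution_primitive hf
  have hlip : LipschitzWith ⟨K, hK.le⟩ fun x => ∫ r in (0 : ℝ)..x, f r := by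
    apply LipschitzWith.of_dist_le_mul
    intro y z
    have hab := fun {y z : ℝ} (hyz : y ≤ z) => hu.abs_sub_le (fun x => (h.left_pos x).le)
      h.left_le_one hK hc hG hyz
    rw [Real.dist_eq, Real.dist_eq]
    change _ ≤ K * _
    rcases le_total y z with hyz | hyz
    · rw [abs_sub_comm, abs_sub_comm y z, abs_of_nonneg (sub_nonneg.2 hyz)]
      exact hab hyz
    · rw [abs_of_nonneg (sub_nonneg.2 hyz)]
      exact hab hyz
  have hd : HasDerivAt (fun x => ∫ r in (0 : ℝ)..x, f r) (f x) x :=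
    intervalIntegral.integral_hasDerivAt_right (hf.1.continuous.intervalIntegrable 0 x)
      (hf.1.continuous.stronglyMeasurableAtFilter _ _) hf.1.continuous.continuousAt
  have := norm_deriv_le_of_lipschitz (x₀ := x) hlip
  rwa [hd.deriv, Real.norm_eq_abs] at this

/-- If there is a supersolution at a lower level, the truncated solutions never reach the lower
truncation height. -/
theorem neg_le_startedSol_of_supersolution (h : IsCoercivePair α β b G) {lam mu N K c s x : ℝ}
    (hK : 0 < K) (hKN : K < N) (hc : 0 < c) (hG : ∀ x p, K ≤ |p| → lam + c * p ^ 2 ≤ G x p)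
    (hup : ∀ x, mu ≤ G x N) (hlm : lam < mu) {u : ℝ → ℝ}
    (hu : IsViscositySupersolution b G lam u) (hsx : s ≤ x) :
    -N ≤ startedSol b G mu N s x := by
  by_contra! hlt
  have hN : 0 < N := hK.trans hKN
  obtain ⟨h0, hgc, hgd⟩ := h.startedSol_spec mu hN.le s
  have hgle : ∀ y, s ≤ y → startedSol b G mu N s y ≤ N := fun y hy => h.startedSol_le hN.le hup hy
  set g := startedSol b G mu N s
  have hc' : ∀ y, ContinuousOn g (Icc s y) := fun y => hgc.mono Icc_subset_Ici_self
  have hivt : ∀ y, s ≤ y → g y ≤ -N → ∃ z ∈ Icc s y, g z = -N := fun y hy hgy =>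
    intermediate_value_Icc' hy (hc' y) ⟨hgy, by linarith⟩
  have hcpt : IsCompact (Icc s x ∩ g ⁻¹' {-N}) :=
    isCompact_Icc.of_isClosed_subset
      ((hc' x).preimage_isClosed_of_isClosed isClosed_Icc isClosed_singleton) inter_subset_left
  obtain ⟨y₀, hy₀, hgy₀⟩ := hivt x hsx hlt.le
  -- Up to the first point `y` where `g = -N` the truncation is inactive, so the primitive `v` of
  -- `g` satisfies `b v'' + G(x, v') = mu` on `(s, y)`.
  obtain ⟨y, ⟨⟨hy, hgy⟩, hleast⟩⟩ := hcpt.exists_isLeast ⟨y₀, hy₀, hgy₀⟩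
  have hgy : g y = -N := hgy
  have hsy : s < y := lt_of_le_of_ne hy.1 (by rintro rfl; linarith)
  have habs : ∀ z ∈ Icc s y, |g z| ≤ N := by
    intro z hz
    refine abs_le.2 ⟨?_, hgle z hz.1⟩
    by_contra! hzN
    obtain ⟨w, hw, hgw⟩ := hivt z hz.1 hzN.le
    have h1 : y ≤ w := hleast ⟨⟨hw.1, hw.2.trans (hz.2.trans hy.2)⟩, hgw⟩
    have h2 : z = y := le_antisymm hz.2 (h1.trans hw.2)
    rw [h2] at hzN; linarith
  have hint : ∀ p ∈ Icc s y, ∀ q ∈ Icc s y, IntervalIntegrable g volume p q := by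
    intro p hp q hq
    apply ContinuousOn.intervalIntegrable
    exact (hc' y).mono (uIcc_subset_Icc hp hq)
  set v : ℝ → ℝ := fun r => ∫ t in s..r, g t with hv
  have hvd : ∀ r ∈ Ioo s y, HasDerivAt v (g r) r := by
    intro r hr
    refine intervalIntegral.integral_hasDerivAt_right
      (hint s ⟨le_rfl, hsy.le⟩ r (Ioo_subset_Icc_self hr)) ?_ (hgd r hr.1).continuousAt
    exact (hgc.mono Ioi_subset_Ici_self).stronglyMeasurableAtFilter isOpen_Ioi r hr.1
  have hvsub : ∀ p ∈ Icc s y, ∀ q ∈ Icc s y, v q - v p = ∫ t in p..q, g t := by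
    intro p hp q hq
    have hs' : s ∈ Icc s y := ⟨le_rfl, hsy.le⟩
    exact intervalIntegral.integral_interval_sub_left (hint s hs' q hq) (hint s hs' p hp)
  have hvc : ContinuousOn v (Icc s y) := by
    have := intervalIntegral.continuousOn_primitive_interval' (hint s ⟨le_rfl, hsy.le⟩ y
      ⟨hsy.le, le_rfl⟩) (left_mem_uIcc)
    rwa [uIcc_of_le hsy.le] at this
  have hlip := fun {p q : ℝ} (hpq : p ≤ q) => hu.abs_sub_le (fun x => (h.left_pos x).le)
    h.left_le_one hK hc hG hpq
  -- A slope strictly between `K` and `N`. Near `s` the slope of `v` exceeds `K'` and near `y` it is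
  -- below `-K'`, while `u` is `K`-Lipschitz; so `u - v` has its minimum in the interior, where
  -- testing `u` with `v` gives `mu ≤ lam`.
  set K' := (K + N) / 2 with hK'
  have hend1 : ∃ r ∈ Icc s y, u r - v r < u s - v s := by
    have h1 : ∀ᶠ r in 𝓝[Icc s y] s, K' < g r :=
      ((hc' y) s ⟨le_rfl, hsy.le⟩).eventually (lt_mem_nhds (by rw [h0]; linarith))
    rw [nhdsWithin_Icc_eq_nhdsGE hsy] at h1
    obtain ⟨r₁, hr₁, hr₁'⟩ := mem_nhdsGE_iff_exists_Icc_subset.1 h1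
    have hr : s < min r₁ y := lt_min hr₁ hsy
    have hrm : min r₁ y ∈ Icc s y := ⟨hr.le, min_le_right _ _⟩
    refine ⟨min r₁ y, hrm, ?_⟩
    have h2 : ∫ _t in s..min r₁ y, K' ≤ ∫ t in s..min r₁ y, g t :=
      intervalIntegral.integral_mono_on hr.le intervalIntegrable_const
        (hint s ⟨le_rfl, hsy.le⟩ _ hrm)
        fun t ht => le_of_lt (hr₁' ⟨ht.1, ht.2.trans (min_le_left _ _)⟩)
    rw [← hvsub s ⟨le_rfl, hsy.le⟩ _ hrm, intervalIntegral.integral_const, smul_eq_mul] at h2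
    have h3 := (abs_le.1 (hlip hr.le)).2
    nlinarith
  have hend2 : ∃ r ∈ Icc s y, u r - v r < u y - v y := by
    have h1 : ∀ᶠ r in 𝓝[Icc s y] y, g r < -K' :=
      ((hc' y) y ⟨hsy.le, le_rfl⟩).eventually (gt_mem_nhds (by rw [hgy]; linarith))
    rw [nhdsWithin_Icc_eq_nhdsLE hsy] at h1
    obtain ⟨r₁, hr₁, hr₁'⟩ := mem_nhdsLE_iff_exists_Icc_subset.1 h1
    have hr : max r₁ s < y := max_lt hr₁ hsy
    have hrm : max r₁ s ∈ Icc s y := ⟨le_max_right _ _, hr.le⟩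
    refine ⟨max r₁ s, hrm, ?_⟩
    have h2 : ∫ t in max r₁ s..y, g t ≤ ∫ _t in max r₁ s..y, -K' :=
      intervalIntegral.integral_mono_on hr.le (hint _ hrm y ⟨hsy.le, le_rfl⟩)
        intervalIntegrable_const
        fun t ht => le_of_lt (hr₁' ⟨(le_max_left _ _).trans ht.1, ht.2⟩)
    rw [← hvsub _ hrm y ⟨hsy.le, le_rfl⟩, intervalIntegral.integral_const, smul_eq_mul] at h2
    have h3 := (abs_le.1 (hlip hr.le)).1
    nlinarith
  obtain ⟨z, hz, hmin⟩ := exists_isLocalMin_of_lt_endpoints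
    (w := fun r => u r - v r) (hu.1.continuousOn.sub hvc) hend1 hend2
  have hzv : ∀ᶠ r in 𝓝 z, HasDerivAt v (g r) r := by
    filter_upwards [Ioo_mem_nhds hz.1 hz.2] with r hr using hvd r hr
  have h1 := hu.le_of_hasDerivAt (h.left_pos z).le hzv (hgd z hz.1) hmin
  rw [truncSlope, truncate_eq_self (habs z (Ioo_subset_Icc_self hz)),
    mul_div_cancel₀ _ (h.left_pos z).ne'] at h1
  linarith

end IsCoercivePair

/-! ### An explicit a priori bound and the set of solvable levels -/

/-- A bound for the solutions of a coercive equation at levels up to `Λ`. -/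
noncomputable def slopeBound (α β Λ : ℝ) : ℝ := 1 + 2 * (|β| + |Λ|) / α

namespace IsCoercivePair

variable {α β : ℝ} {b : ℝ → ℝ} {G : ℝ → ℝ → ℝ}

theorem slopeBound_ge_one (h : IsCoercivePair α β b G) (Λ : ℝ) : 1 ≤ slopeBound α β Λ := by
  have := h.pos
  unfold slopeBound
  linarith [(by positivity : 0 ≤ 2 * (|β| + |Λ|) / α)]

/-- Half of `α * p ^ 2` absorbs `β` and the level, the other half remains. The summand `1` in
`slopeBound` ensures `|p| ≤ p ^ 2`. -/
theorem add_le_of_slopeBound_le (h : IsCoercivePair α β b G) {lam Λ : ℝ} (hl : lam ≤ Λ)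
    (x p : ℝ) (hp : slopeBound α β Λ ≤ |p|) : lam + α / 2 * p ^ 2 ≤ G x p := by
  have hα := h.pos
  have h1 := h.lower x p
  have h2 := h.slopeBound_ge_one Λ
  have h3 : 2 * (|β| + |Λ|) / α ≤ |p| := by unfold slopeBound at hp; linarith
  rw [div_le_iff₀ hα] at h3
  have h4 : |p| * 1 ≤ |p| * |p| := mul_le_mul_of_nonneg_left (h2.trans hp) (abs_nonneg p)
  rw [abs_mul_abs_self] at h4
  nlinarith [le_abs_self β, le_abs_self Λ]

end IsCoercivePair

/-- No solution starting from the height `N` of the truncated equation falls below `-N`. -/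
def TruncatedSurvives (b : ℝ → ℝ) (G : ℝ → ℝ → ℝ) (lam N : ℝ) : Prop :=
  ∀ s x, s ≤ x → -N ≤ startedSol b G lam N s x

namespace IsCoercivePair

variable {α β : ℝ} {b : ℝ → ℝ} {G : ℝ → ℝ → ℝ}

theorem level_le_of_slopeBound_le (h : IsCoercivePair α β b G) {lam Λ N : ℝ}
    (hl : lam ≤ Λ) (hN : slopeBound α β Λ ≤ N) (x : ℝ) : lam ≤ G x N := by
  have h1 := h.add_le_of_slopeBound_le hl x N (hN.trans (le_abs_self N))
  have := h.pos
  nlinarith [sq_nonneg N]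

theorem abs_le_slopeBound (h : IsCoercivePair α β b G) {lam Λ : ℝ} (hl : lam ≤ Λ) {f : ℝ → ℝ}
    (hf : IsODESolution b G lam f) (x : ℝ) : |f x| ≤ slopeBound α β Λ :=
  h.abs_le_of_isODESolution (by linarith [h.slopeBound_ge_one Λ]) (half_pos h.pos)
    (h.add_le_of_slopeBound_le hl) hf x

theorem truncatedSurvives_of_isODESolution (h : IsCoercivePair α β b G) {lam Λ N : ℝ}
    (hl : lam ≤ Λ) (hN : slopeBound α β Λ ≤ N) {f : ℝ → ℝ} (hf : IsODESolution b G lam f) :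
    TruncatedSurvives b G lam N := by
  intro s x hsx
  have hb := fun x => (h.abs_le_slopeBound hl hf x).trans hN
  exact (abs_le.1 (hb x)).1.trans (h.le_startedSol_of_isODESolution hf hb hsx)

theorem truncatedSurvives_of_supersolution (h : IsCoercivePair α β b G) {lam mu N : ℝ}
    (hl : lam < mu) (hN : slopeBound α β mu < N) {u : ℝ → ℝ}
    (hu : IsViscositySupersolution b G lam u) : TruncatedSurvives b G mu N := fun _ _ hsx =>
  h.neg_le_startedSol_of_supersolution (by linarith [h.slopeBound_ge_one mu]) hN (half_pos h.pos)
    (h.add_le_of_slopeBound_le hl.le) (h.level_le_of_slopeBound_le le_rfl hN.le) hl hu hsx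

theorem truncatedSurvives_of_barrier (h : IsCoercivePair α β b G) {lam N M : ℝ} (hM : |M| ≤ N)
    (hlow : ∀ x, G x M ≤ lam) : TruncatedSurvives b G lam N := fun _ _ hsx =>
  (neg_le_of_abs_le hM).trans (h.le_startedSol_of_barrier hM hlow hsx)

theorem isODESolution_maxSol_of_truncatedSurvives (h : IsCoercivePair α β b G) {lam Λ N : ℝ}
    (hl : lam ≤ Λ) (hN : slopeBound α β Λ ≤ N) (hs : TruncatedSurvives b G lam N) :
    IsODESolution b G lam (maxSol b G lam N) :=
  h.isODESolution_maxSol (by linarith [h.slopeBound_ge_one Λ]) (h.level_le_of_slopeBound_le hl hN) hs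

/-- Monotonicity in the starting point reduces to integers and continuity in `x` to rationals. The
countable form makes survival a measurable event. -/
theorem truncatedSurvives_iff_rat (h : IsCoercivePair α β b G) {lam Λ N : ℝ}
    (hl : lam ≤ Λ) (hN : slopeBound α β Λ ≤ N) : TruncatedSurvives b G lam N ↔
      ∀ (m : ℕ) (q : ℚ), -(m : ℝ) ≤ q → -N ≤ startedSol b G lam N (-(m : ℝ)) q := by
  refine ⟨fun hs m q hq => hs _ _ hq, fun hs s x hsx => ?_⟩
  have hN0 : 0 ≤ N := by linarith [h.slopeBound_ge_one Λ]
  obtain ⟨m, hm⟩ := exists_nat_gt (-s)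
  have hms : -(m : ℝ) < s := by linarith
  refine le_trans ?_ (h.startedSol_antitone hN0 (h.level_le_of_slopeBound_le hl hN) hms.le hsx)
  by_contra! hlt
  have h1 : ∀ᶠ y in 𝓝 x, startedSol b G lam N (-(m : ℝ)) y < -N ∧ -(m : ℝ) < y :=
    (((h.startedSol_spec lam hN0 _).2.2 x (hms.trans_le hsx)).continuousAt.eventually
      (gt_mem_nhds hlt)).and (lt_mem_nhds (hms.trans_le hsx))
  obtain ⟨_, ⟨q, rfl⟩, hy⟩ := Rat.denseRange_cast (𝕜 := ℝ) |>.inter_nhds_nonempty h1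
  exact absurd (hs m q hy.2.le) (not_le.2 hy.1)

/-- Solvability of the first order equation on the line passes to decreasing limits of levels. -/
theorem exists_isODESolution_of_antitone (h : IsCoercivePair α β b G) {l : ℕ → ℝ} {lam : ℝ}
    (hl : Antitone l) (hlim : Tendsto l atTop (𝓝 lam))
    (hs : ∀ n, ∃ f, IsODESolution b G (l n) f) : ∃ f, IsODESolution b G lam f := by
  set N := slopeBound α β (l 0)
  have hN : 0 ≤ N := by linarith [h.slopeBound_ge_one (l 0)]
  have hl0 : ∀ n, l n ≤ l 0 := fun n => hl (Nat.zero_le n)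
  have hsv : ∀ n, TruncatedSurvives b G (l n) N := fun n =>
    (hs n).elim fun f hf => h.truncatedSurvives_of_isODESolution (hl0 n) le_rfl hf
  have hsol := fun n => h.isODESolution_maxSol_of_truncatedSurvives (hl0 n) le_rfl (hsv n)
  have hab := fun n x => h.abs_le_slopeBound (hl0 n) (hsol n) x
  -- All levels share the truncation height `N`, so the maximal solutions decrease along the
  -- sequence, stay above `-N`, and converge pointwise.
  have hanti : ∀ x, Antitone fun n => maxSol b G (l n) N x := fun x m n hmn =>
    h.maxSol_mono_level hN (hl hmn) (h.level_le_of_slopeBound_le (hl0 m) le_rfl) (hsv n) x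
  have hbdd : ∀ x, BddBelow (range fun n => maxSol b G (l n) N x) := fun x =>
    ⟨-N, by rintro _ ⟨n, rfl⟩; exact (abs_le.1 (hab n x)).1⟩
  exact ⟨_, h.isODESolution_of_tendsto hN hlim
    (fun R => Eventually.of_forall fun n x _ => ⟨hab n x, h.isODESolution_iff.1 (hsol n) x⟩)
    fun x => tendsto_atTop_ciInf (hanti x) (hbdd x)⟩

/-- Coercivity forces the levels of solvability to be bounded below. -/
theorem neg_le_of_isODESolution (h : IsCoercivePair α β b G) {lam : ℝ} {f : ℝ → ℝ}
    (hf : IsODESolution b G lam f) : -β ≤ lam := by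
  by_contra! hlt
  -- Below `-β` the coercivity condition holds at every `p`, so the a priori bound applies with
  -- every `K = ε > 0`.
  have h0 : ∀ x, f x = 0 := by
    intro x
    rw [← abs_nonpos_iff]
    refine le_of_forall_pos_le_add fun ε hε => ?_
    rw [zero_add]
    exact h.abs_le_of_isODESolution hε h.pos (fun x p _ => by linarith [h.lower x p]) hf x
  have h1 := hf.2 0
  have h2 := h.lower 0 0
  rw [show f = fun _ => 0 from funext h0, deriv_const] at h1
  linarith

end IsCoercivePair

/-! ### Ergodic actions and stationary functions -/

section Action

variable {Ω : Type*} [MeasurableSpace Ω] {P : Measure Ω} {τ : ℝ → Ω → Ω}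

theorem IsErgodicAction.neg (hτ : IsErgodicAction P τ) : IsErgodicAction P fun x => τ (-x) where
  zero ω := by rw [neg_zero]; exact hτ.zero ω
  add x y ω := by rw [neg_add]; exact hτ.add _ _ ω
  preserving x := hτ.preserving (-x)
  ergodic φ hφ h := hτ.ergodic φ hφ fun x => by simpa using h (-x)

/-- Zero-one law for events that are invariant under forward shifts. -/
theorem IsErgodicAction.ae_mem_or_ae_notMem [IsProbabilityMeasure P] (hτ : IsErgodicAction P τ)
    {A : Set Ω} (hA : MeasurableSet A) (h : ∀ x, 0 ≤ x → ∀ᵐ ω ∂P, ω ∈ A → τ x ω ∈ A) :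
    (∀ᵐ ω ∂P, ω ∈ A) ∨ ∀ᵐ ω ∂P, ω ∉ A := by
  have h1 : ∀ x, 0 ≤ x → ∀ᵐ ω ∂P, τ x ω ∈ A ↔ ω ∈ A := by
    intro x hx
    have hm := (hτ.preserving x).measure_preimage hA.nullMeasurableSet
    -- Up to a null set `A` lies in its preimage, which has the same finite measure, so the two
    -- agree.
    have hae : A =ᵐ[P] τ x ⁻¹' A :=
      ae_eq_of_ae_subset_of_measure_ge (h x hx) hm.le hA.nullMeasurableSet (measure_ne_top _ _)
    filter_upwards [hae.mem_iff] with ω hω using hω.symm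
  have h2 : ∀ x, ∀ᵐ ω ∂P, τ x ω ∈ A ↔ ω ∈ A := by
    intro x
    rcases le_total 0 x with hx | hx
    · exact h1 x hx
    · filter_upwards [(hτ.preserving x).quasiMeasurePreserving.ae (h1 (-x) (by linarith))] with ω hω
      rw [← hτ.add, neg_add_cancel, hτ.zero] at hω
      exact hω.symm
  obtain ⟨c, hc⟩ := hτ.ergodic (A.indicator 1) (measurable_one.indicator hA) fun x => by
    filter_upwards [h2 x] with ω hω
    by_cases hm : ω ∈ A
    · rw [indicator_of_mem hm, indicator_of_mem (hω.2 hm)]; rfl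
    · rw [indicator_of_notMem hm, indicator_of_notMem (fun h => hm (hω.1 h))]
  by_cases h1c : c = 1
  · left
    filter_upwards [hc] with ω hω
    by_contra hm
    rw [indicator_of_notMem hm, h1c] at hω
    exact zero_ne_one hω
  · right
    filter_upwards [hc] with ω hω hm
    rw [indicator_of_mem hm] at hω
    exact h1c hω.symm

theorem IsStationaryFun.eq_zero_shift {f : ℝ → Ω → ℝ} (hf : IsStationaryFun τ f) (x : ℝ) (ω : Ω) :
    f x ω = f 0 (τ x ω) := by
  simpa using hf.shift 0 x ω

theorem IsStationaryFun.measurable_apply {f : ℝ → Ω → ℝ} (hf : IsStationaryFun τ f) (x : ℝ) :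
    Measurable (f x) :=
  hf.measurable.comp measurable_prodMk_left

/-- An almost sure inequality at the origin holds simultaneously at all points of the line. -/
theorem IsStationaryFun.ae_forall_le (hτ : IsErgodicAction P τ) {f g : ℝ → Ω → ℝ}
    (hf : IsStationaryFun τ f) (hg : IsStationaryFun τ g)
    (hfc : ∀ᵐ ω ∂P, Continuous fun x => f x ω) (hgc : ∀ᵐ ω ∂P, Continuous fun x => g x ω)
    (h : ∀ᵐ ω ∂P, f 0 ω ≤ g 0 ω) : ∀ᵐ ω ∂P, ∀ x, f x ω ≤ g x ω := by
  have hq : ∀ᵐ ω ∂P, ∀ q : ℚ, f q ω ≤ g q ω := by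
    rw [ae_all_iff]
    intro q
    filter_upwards [(hτ.preserving (q : ℝ)).quasiMeasurePreserving.ae h] with ω hω
    rwa [hf.eq_zero_shift, hg.eq_zero_shift]
  filter_upwards [hq, hfc, hgc] with ω hω h1 h2 x
  exact (Rat.denseRange_cast (𝕜 := ℝ)).induction_on x (isClosed_le h1 h2) hω

theorem IsStationaryFun.limsup {f : ℕ → ℝ → Ω → ℝ} (hf : ∀ n, IsStationaryFun τ (f n)) :
    IsStationaryFun τ fun x ω => limsup (fun n => f n x ω) atTop where
  measurable := Measurable.limsup fun n => (hf n).measurable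
  shift x y ω := by simp_rw [fun n => (hf n).shift x y ω]

end Action

/-! ### Stationary solutions and their means -/

/-- The data of a stationary ergodic family of coercive equations on the line. -/
structure IsRandomCoercivePair {Ω : Type*} [MeasurableSpace Ω] (P : Measure Ω) (τ : ℝ → Ω → Ω)
    (α β : ℝ) (a : ℝ → Ω → ℝ) (H : ℝ → ℝ → Ω → ℝ) : Prop where
  action : IsErgodicAction P τ
  stationary_left : IsStationaryFun τ a
  stationary_right : IsStationaryHamiltonian τ H
  pair : ∀ᵐ ω ∂P, IsCoercivePair α β (fun x => a x ω) (fun x p => H x p ω)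
  bounded : ∀ M, ∃ C, ∀ x ω, H x M ω ≤ C

namespace IsRandomCoercivePair

variable {Ω : Type*} [MeasurableSpace Ω] {P : Measure Ω} {τ : ℝ → Ω → Ω} {α β : ℝ}
  {a : ℝ → Ω → ℝ} {H : ℝ → ℝ → Ω → ℝ}

/-- If `g` solves the reflected equation then `x ↦ -g (-x)` solves the original one. Solutions with
large mean for one thus give solutions with very negative mean for the other. -/
theorem neg (h : IsRandomCoercivePair P τ α β a H) : IsRandomCoercivePair P (fun x => τ (-x)) α β
    (fun x => a (-x)) (fun x p => H (-x) (-p)) where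
  action := h.action.neg
  stationary_left :=
    ⟨h.stationary_left.measurable.comp (measurable_fst.neg.prodMk measurable_snd),
      fun x y ω => by rw [neg_add, h.stationary_left.shift]⟩
  stationary_right :=
    ⟨h.stationary_right.measurable.comp
      (measurable_fst.neg.prodMk (measurable_snd.fst.neg.prodMk measurable_snd.snd)),
      fun x y p ω => by rw [neg_add, h.stationary_right.shift]⟩
  pair := by
    filter_upwards [h.pair] with ω hω
    refine ⟨hω.pos, hω.continuous_left.comp continuous_neg, fun x => hω.left_pos _,
      fun x => hω.left_le_one _,
      hω.continuous_right.comp (continuous_fst.neg.prodMk continuous_snd.neg), fun R => ?_,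
      fun x p => by simpa using hω.lower (-x) (-p)⟩
    obtain ⟨L, hL0, hL⟩ := hω.lipschitz R
    refine ⟨L, hL0, fun x p q hp hq => ?_⟩
    have := hL (-x) (-p) (-q) (by rwa [abs_neg]) (by rwa [abs_neg])
    rwa [neg_sub_neg, abs_sub_comm q p] at this
  bounded M := by
    obtain ⟨C, hC⟩ := h.bounded (-M)
    exact ⟨C, fun x ω => hC (-x) ω⟩

theorem measurable_truncSlope (h : IsRandomCoercivePair P τ α β a H) (lam N : ℝ) :
    Measurable fun y : (ℝ × Ω) × ℝ × ℝ =>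
      truncSlope (fun x => a x y.1.2) (fun x p => H x p y.1.2) lam N (y.1.1 + y.2.1) y.2.2 := by
  have hx : Measurable fun y : (ℝ × Ω) × ℝ × ℝ => y.1.1 + y.2.1 :=
    measurable_fst.fst.add measurable_snd.fst
  have hp : Measurable fun y : (ℝ × Ω) × ℝ × ℝ => truncate N y.2.2 :=
    (continuous_truncate N).measurable.comp measurable_snd.snd
  have hω : Measurable fun y : (ℝ × Ω) × ℝ × ℝ => y.1.2 := measurable_fst.snd
  have h1 : Measurable fun y : (ℝ × Ω) × ℝ × ℝ => H (y.1.1 + y.2.1) (truncate N y.2.2) y.1.2 :=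
    h.stationary_right.measurable.comp (hx.prodMk (hp.prodMk hω))
  have h2 : Measurable fun y : (ℝ × Ω) × ℝ × ℝ => a (y.1.1 + y.2.1) y.1.2 :=
    h.stationary_left.measurable.comp (hx.prodMk hω)
  exact (h1.const_sub lam).div h2

theorem measurable_startedSol (h : IsRandomCoercivePair P τ α β a H) (lam N : ℝ) :
    Measurable fun z : ℝ × ℝ × Ω =>
      startedSol (fun x => a x z.2.2) (fun x p => H x p z.2.2) lam N z.1 z.2.1 := by
  have h1 := measurable_picardFlow (v := fun (y : ℝ × Ω) r p =>
    truncSlope (fun x => a x y.2) (fun x p => H x p y.2) lam N (y.1 + r) p)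
    (h.measurable_truncSlope lam N) N
  have h2 : Measurable fun z : ℝ × ℝ × Ω => ((z.1, z.2.2), z.2.1 - z.1) :=
    (measurable_fst.prodMk measurable_snd.snd).prodMk (measurable_snd.fst.sub measurable_fst)
  have h3 := h1.comp h2
  unfold startedSol
  exact h3

theorem startedSol_shift (h : IsRandomCoercivePair P τ α β a H) (lam N s x y : ℝ) (ω : Ω) :
    startedSol (fun x => a x ω) (fun x p => H x p ω) lam N (s + y) (x + y) =
      startedSol (fun x => a x (τ y ω)) (fun x p => H x p (τ y ω)) lam N s x := by
  unfold startedSol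
  have e : ∀ r p, truncSlope (fun x => a x ω) (fun x p => H x p ω) lam N (s + y + r) p
      = truncSlope (fun x => a x (τ y ω)) (fun x p => H x p (τ y ω)) lam N (s + r) p := by
    intro r p
    simp only [truncSlope, add_right_comm s y r, h.stationary_left.shift, h.stationary_right.shift]
  simp only [e, add_sub_add_right_eq_sub]

/-- The starting points `x - n` move with `x`, so the shift identity is exact for every `ω`, even
where the pair fails to be coercive. -/
theorem isStationaryFun_maxSol (h : IsRandomCoercivePair P τ α β a H) (lam N : ℝ) :
    IsStationaryFun τ fun x ω => maxSol (fun x => a x ω) (fun x p => H x p ω) lam N x where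
  measurable := by
    refine Measurable.limsup fun n => ?_
    exact (h.measurable_startedSol lam N).comp
      (f := fun z : ℝ × Ω => (z.1 - (n : ℝ), z.1, z.2)) (by fun_prop)
  shift x y ω := by
    unfold maxSol
    simp only [← h.startedSol_shift, sub_add_eq_add_sub]

theorem isODESolution_shift (h : IsRandomCoercivePair P τ α β a H) {lam : ℝ} {f : ℝ → ℝ} {ω : Ω}
    (hf : IsODESolution (fun x => a x ω) (fun x p => H x p ω) lam f) (y : ℝ) :
    IsODESolution (fun x => a x (τ y ω)) (fun x p => H x p (τ y ω)) lam fun x => f (x + y) := by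
  refine ⟨hf.1.comp (contDiff_id.add contDiff_const), fun x => ?_⟩
  rw [deriv_comp_add_const]
  simp only [← h.stationary_left.shift, ← h.stationary_right.shift]
  exact hf.2 (x + y)

/-- Solvability of the equation at a given level obeys a zero-one law. -/
theorem ae_exists_or_ae_not_exists [IsProbabilityMeasure P] (h : IsRandomCoercivePair P τ α β a H)
    (lam : ℝ) : (∀ᵐ ω ∂P, ∃ f, IsODESolution (fun x => a x ω) (fun x p => H x p ω) lam f) ∨
      ∀ᵐ ω ∂P, ¬ ∃ f, IsODESolution (fun x => a x ω) (fun x p => H x p ω) lam f := by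
  set N := slopeBound α β lam
  -- A measurable event that almost surely coincides with solvability.
  set A : Set Ω := {ω | ∀ (m : ℕ) (q : ℚ), -(m : ℝ) ≤ q →
    -N ≤ startedSol (fun x => a x ω) (fun x p => H x p ω) lam N (-(m : ℝ)) q} with hAdef
  have hA : MeasurableSet A := by
    simp only [hAdef, ofPred_forall]
    refine .iInter fun m => .iInter fun q => .iInter fun _ => measurableSet_le measurable_const ?_
    exact (h.measurable_startedSol lam N).comp
      (f := fun ω : Ω => (-(m : ℝ), (q : ℝ), ω)) (by fun_prop)
  have hAiff : ∀ᵐ ω ∂P, ω ∈ A ↔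
      ∃ f, IsODESolution (fun x => a x ω) (fun x p => H x p ω) lam f := by
    filter_upwards [h.pair] with ω hω
    rw [hAdef, mem_ofPred_eq, ← hω.truncatedSurvives_iff_rat le_rfl le_rfl]
    exact ⟨fun hs => ⟨_, hω.isODESolution_maxSol_of_truncatedSurvives le_rfl le_rfl hs⟩,
      fun ⟨f, hf⟩ => hω.truncatedSurvives_of_isODESolution le_rfl le_rfl hf⟩
  refine (h.action.ae_mem_or_ae_notMem hA fun x _ => ?_).imp (fun h1 => ?_) (fun h1 => ?_)
  · filter_upwards [hAiff, (h.action.preserving x).quasiMeasurePreserving.ae hAiff] with ω h1 h2 h3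
    obtain ⟨f, hf⟩ := h1.1 h3
    exact h2.2 ⟨_, h.isODESolution_shift hf x⟩
  · filter_upwards [h1, hAiff] with ω h2 h3 using h3.1 h2
  · filter_upwards [h1, hAiff] with ω h2 h3 using fun h4 => h2 (h3.2 h4)

/-- The levels at which the equation is almost surely solvable on the line. -/
def solvableLevels (P : Measure Ω) (a : ℝ → Ω → ℝ) (H : ℝ → ℝ → Ω → ℝ) : Set ℝ :=
  {lam | ∀ᵐ ω ∂P, ∃ f, IsODESolution (fun x => a x ω) (fun x p => H x p ω) lam f}

/-- The primitive of a solution is a supersolution at level `lam`, which keeps the truncated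
solutions alive at every higher level. The height `slopeBound α β mu + 1` meets the strict
inequality required there. -/
theorem mem_solvableLevels_of_le (h : IsRandomCoercivePair P τ α β a H) {lam mu : ℝ}
    (hlam : lam ∈ solvableLevels P a H) (hl : lam ≤ mu) : mu ∈ solvableLevels P a H := by
  rcases hl.eq_or_lt with rfl | hl
  · exact hlam
  filter_upwards [hlam, h.pair] with ω ⟨f, hf⟩ hω
  exact ⟨_, hω.isODESolution_maxSol_of_truncatedSurvives le_rfl (le_of_lt (lt_add_one _))
    (hω.truncatedSurvives_of_supersolution hl (lt_add_one _)
      (hω.isViscositySupersolution_primitive hf))⟩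

theorem bddBelow_solvableLevels [IsProbabilityMeasure P] (h : IsRandomCoercivePair P τ α β a H) :
    BddBelow (solvableLevels P a H) := by
  refine ⟨-β, fun lam hlam => ?_⟩
  have hlam : ∀ᵐ ω ∂P, ∃ f, IsODESolution (fun x => a x ω) (fun x p => H x p ω) lam f := hlam
  obtain ⟨ω, ⟨f, hf⟩, hω⟩ := (hlam.and h.pair).exists
  exact hω.neg_le_of_isODESolution hf

theorem maxSol_mem_stationarySolutions (h : IsRandomCoercivePair P τ α β a H) {lam Λ N : ℝ}
    (hl : lam ≤ Λ) (hN : slopeBound α β Λ ≤ N)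
    (hs : ∀ᵐ ω ∂P, TruncatedSurvives (fun x => a x ω) (fun x p => H x p ω) lam N) :
    (fun x ω => maxSol (fun x => a x ω) (fun x p => H x p ω) lam N x) ∈
      stationarySolutions P τ a H lam := by
  refine ⟨h.isStationaryFun_maxSol lam N, ⟨slopeBound α β lam, ?_⟩, ?_⟩
  · filter_upwards [h.pair, hs] with ω hω hsω x
    exact hω.abs_le_slopeBound le_rfl
      (hω.isODESolution_maxSol_of_truncatedSurvives hl hN hsω) x
  · filter_upwards [h.pair, hs] with ω hω hsω
    exact hω.isODESolution_maxSol_of_truncatedSurvives hl hN hsω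

theorem ae_abs_le_slopeBound (h : IsRandomCoercivePair P τ α β a H) {lam Λ : ℝ} (hl : lam ≤ Λ)
    {f : ℝ → Ω → ℝ} (hf : f ∈ stationarySolutions P τ a H lam) :
    ∀ᵐ ω ∂P, ∀ x, |f x ω| ≤ slopeBound α β Λ := by
  filter_upwards [h.pair, hf.2.2] with ω hω hfω x using hω.abs_le_slopeBound hl hfω x

theorem integrable_of_mem [IsProbabilityMeasure P] {lam : ℝ}
    {f : ℝ → Ω → ℝ} (hf : f ∈ stationarySolutions P τ a H lam) : Integrable (f 0) P := by
  obtain ⟨C, hC⟩ := hf.2.1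
  exact Integrable.of_bound (hf.1.measurable_apply 0).aestronglyMeasurable C
    (hC.mono fun ω hω => hω 0)

theorem ae_continuous {lam : ℝ} {f : ℝ → Ω → ℝ} (hf : f ∈ stationarySolutions P τ a H lam) :
    ∀ᵐ ω ∂P, Continuous fun x => f x ω :=
  hf.2.2.mono fun _ hω => hω.1.continuous

theorem thetaMap_nonempty (h : IsRandomCoercivePair P τ α β a H) {lam : ℝ}
    (hlam : lam ∈ solvableLevels P a H) : (thetaMap P τ a H lam).Nonempty := by
  refine ⟨_, _, h.maxSol_mem_stationarySolutions le_rfl le_rfl ?_, rfl⟩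
  filter_upwards [h.pair, hlam] with ω hω ⟨f, hf⟩
  exact hω.truncatedSurvives_of_isODESolution le_rfl le_rfl hf

theorem abs_le_of_mem_thetaMap [IsProbabilityMeasure P] (h : IsRandomCoercivePair P τ α β a H)
    {lam Λ θ : ℝ} (hl : lam ≤ Λ) (hθ : θ ∈ thetaMap P τ a H lam) : |θ| ≤ slopeBound α β Λ := by
  obtain ⟨f, hf, rfl⟩ := hθ
  have := norm_integral_le_of_norm_le_const (μ := P) (f := f 0)
    ((h.ae_abs_le_slopeBound hl hf).mono fun ω hω => hω 0)
  simpa using this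

/-- Large constants are lower barriers, so there are stationary solutions with large mean. -/
theorem exists_large_mem_thetaMap [IsProbabilityMeasure P] (h : IsRandomCoercivePair P τ α β a H)
    (M : ℝ) : ∃ Λ, ∀ lam, Λ ≤ lam → ∃ θ ∈ thetaMap P τ a H lam, M ≤ θ := by
  obtain ⟨C, hC⟩ := h.bounded M
  -- `C` makes the constant `M` a subsolution at level `lam`; `α * |M|` places `|M|` below the
  -- truncation height.
  refine ⟨max C (α * |M|), fun lam hlam => ?_⟩
  obtain ⟨ω₀, hω₀⟩ := h.pair.exists
  have hα := hω₀.pos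
  have hMN : |M| ≤ slopeBound α β lam := by
    have h1 : α * |M| ≤ |lam| := (le_max_right _ _).trans (hlam.trans (le_abs_self _))
    have h2 : |M| ≤ 2 * (|β| + |lam|) / α := by
      rw [le_div_iff₀ hα]
      nlinarith [abs_nonneg β, abs_nonneg lam]
    unfold slopeBound
    linarith
  have hCl : C ≤ lam := (le_max_left _ _).trans hlam
  have hs : ∀ᵐ ω ∂P, TruncatedSurvives (fun x => a x ω) (fun x p => H x p ω) lam
      (slopeBound α β lam) := by
    filter_upwards [h.pair] with ω hω
    exact hω.truncatedSurvives_of_barrier hMN fun x => (hC x ω).trans hCl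
  have hmem := h.maxSol_mem_stationarySolutions le_rfl le_rfl hs
  refine ⟨_, ⟨_, hmem, rfl⟩, ?_⟩
  have h1 : ∀ᵐ ω ∂P, M ≤ maxSol (fun x => a x ω) (fun x p => H x p ω) lam
      (slopeBound α β lam) 0 := by
    filter_upwards [h.pair, hs] with ω hω hsω
    exact hω.le_maxSol (by linarith [hω.slopeBound_ge_one lam])
      (hω.level_le_of_slopeBound_le le_rfl le_rfl) hsω
      fun s hs0 => hω.le_startedSol_of_barrier hMN (fun x => (hC x ω).trans hCl) hs0
  have := integral_mono_ae (integrable_const M) (integrable_of_mem hmem) h1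
  simpa using this

theorem neg_mem_thetaMap {lam θ : ℝ}
    (hθ : θ ∈ thetaMap P (fun x => τ (-x)) (fun x => a (-x)) (fun x p => H (-x) (-p)) lam) :
    -θ ∈ thetaMap P τ a H lam := by
  obtain ⟨f, ⟨hf, ⟨C, hC⟩, hode⟩, rfl⟩ := hθ
  refine ⟨fun x ω => -f (-x) ω, ⟨⟨?_, fun x y ω => ?_⟩, ⟨C, ?_⟩, ?_⟩, ?_⟩
  · exact (hf.measurable.comp (measurable_fst.neg.prodMk measurable_snd)).neg
  · rw [neg_add, hf.shift, neg_neg]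
  · filter_upwards [hC] with ω hω x
    rw [abs_neg]; exact hω (-x)
  · filter_upwards [hode] with ω hω
    refine ⟨(hω.1.comp contDiff_neg).neg, fun x => ?_⟩
    have h1 : HasDerivAt (fun x => -f (-x) ω) (deriv (fun x => f x ω) (-x)) x := by
      have := ((hω.1.differentiable one_ne_zero (-x)).hasDerivAt.comp x (hasDerivAt_neg x)).neg
      refine this.congr_deriv (by ring)
    rw [h1.deriv]
    simpa using hω.2 (-x)
  · simp [integral_neg]

theorem mem_solvableLevels_of_thetaMap_nonempty {lam : ℝ}
    (hne : (thetaMap P τ a H lam).Nonempty) : lam ∈ solvableLevels P a H := by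
  obtain ⟨_, f, hf, -⟩ := hne
  exact hf.2.2.mono fun ω hω => ⟨_, hω⟩

theorem solvableLevels_nonempty [IsProbabilityMeasure P] (h : IsRandomCoercivePair P τ α β a H) :
    (solvableLevels P a H).Nonempty := by
  obtain ⟨Λ, hΛ⟩ := h.exists_large_mem_thetaMap 0
  obtain ⟨θ, hθ, -⟩ := hΛ Λ le_rfl
  exact ⟨Λ, mem_solvableLevels_of_thetaMap_nonempty ⟨θ, hθ⟩⟩

theorem sInf_mem_solvableLevels [IsProbabilityMeasure P] (h : IsRandomCoercivePair P τ α β a H) :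
    sInf (solvableLevels P a H) ∈ solvableLevels P a H := by
  set l : ℕ → ℝ := fun n => sInf (solvableLevels P a H) + 1 / ((n : ℝ) + 1)
  have hl : ∀ n, l n ∈ solvableLevels P a H := by
    intro n
    obtain ⟨mu, hmu, hlt⟩ := exists_lt_of_csInf_lt h.solvableLevels_nonempty
      (show sInf (solvableLevels P a H) < l n from lt_add_of_pos_right _ Nat.one_div_pos_of_nat)
    exact h.mem_solvableLevels_of_le hmu hlt.le
  have hanti : Antitone l := fun m n hmn =>
    add_le_add_right (Nat.one_div_le_one_div hmn) _
  have hlim : Tendsto l atTop (𝓝 (sInf (solvableLevels P a H))) := by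
    simpa only [add_zero] using
      tendsto_one_div_add_atTop_nhds_zero_nat.const_add (sInf (solvableLevels P a H))
  filter_upwards [h.pair, ae_all_iff.2 hl] with ω hω hs
  exact hω.exists_isODESolution_of_antitone hanti hlim hs

theorem mem_solvableLevels_iff [IsProbabilityMeasure P] (h : IsRandomCoercivePair P τ α β a H)
    {lam : ℝ} : lam ∈ solvableLevels P a H ↔ sInf (solvableLevels P a H) ≤ lam :=
  ⟨fun hl => csInf_le h.bddBelow_solvableLevels hl,
    fun hl => h.mem_solvableLevels_of_le h.sInf_mem_solvableLevels hl⟩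

/-- The critical value is almost surely the smallest level of almost sure solvability. -/
theorem ae_isGLB_supersolutionLevels [IsProbabilityMeasure P]
    (h : IsRandomCoercivePair P τ α β a H) :
    ∀ᵐ ω ∂P, IsGLB (supersolutionLevels (fun x => a x ω) (fun x p => H x p ω))
      (sInf (solvableLevels P a H)) := by
  -- The zero-one law holds simultaneously only for countably many levels. Rational ones suffice,
  -- since one fits between any two distinct levels.
  have h1 : ∀ᵐ ω ∂P, ∀ r : ℚ, (∃ f, IsODESolution (fun x => a x ω) (fun x p => H x p ω) r f) ↔
      (r : ℝ) ∈ solvableLevels P a H := by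
    rw [ae_all_iff]
    intro r
    rcases h.ae_exists_or_ae_not_exists r with hr | hr
    · filter_upwards [hr] with ω hω using iff_of_true hω hr
    · filter_upwards [hr] with ω hω
      refine iff_of_false hω fun hr' => ?_
      obtain ⟨ω', h1, h2⟩ := (hr.and hr').exists
      exact h1 h2
  filter_upwards [h.pair, h1] with ω hω hr
  refine ⟨fun lam ⟨u, hu⟩ => ?_, fun m hm => ?_⟩
  · by_contra! hlt
    obtain ⟨r, hr1, hr2⟩ := exists_rat_btwn hlt
    have := (hr r).1 ⟨_, hω.isODESolution_maxSol_of_truncatedSurvives le_rfl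
      (le_of_lt (lt_add_one _)) (hω.truncatedSurvives_of_supersolution hr1 (lt_add_one _) hu)⟩
    exact absurd (h.mem_solvableLevels_iff.1 this) (not_le.2 hr2)
  · by_contra! hlt
    obtain ⟨r, hr1, hr2⟩ := exists_rat_btwn hlt
    obtain ⟨f, hf⟩ := (hr r).2 (h.mem_solvableLevels_iff.2 hr1.le)
    exact absurd (hm ⟨_, hω.isViscositySupersolution_primitive hf⟩) (not_le.2 hr2)

/-- Stationary solutions at ordered levels are themselves almost surely ordered. -/
theorem ae_le_or_ae_lt [IsProbabilityMeasure P] (h : IsRandomCoercivePair P τ α β a H)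
    {lam mu : ℝ} (hl : lam ≤ mu) {f g : ℝ → Ω → ℝ} (hf : f ∈ stationarySolutions P τ a H lam)
    (hg : g ∈ stationarySolutions P τ a H mu) :
    (∀ᵐ ω ∂P, f 0 ω ≤ g 0 ω) ∨ ∀ᵐ ω ∂P, g 0 ω < f 0 ω := by
  -- Comparison propagates the inequality to the right, so this event is invariant under forward
  -- shifts.
  refine (h.action.ae_mem_or_ae_notMem (A := {ω | f 0 ω ≤ g 0 ω})
    (measurableSet_le (hf.1.measurable_apply 0) (hg.1.measurable_apply 0))
    fun x hx => ?_).imp id fun h1 => ?_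
  · filter_upwards [h.pair, hf.2.2, hg.2.2] with ω hω hfω hgω h0
    rw [← hf.1.eq_zero_shift, ← hg.1.eq_zero_shift]
    exact hω.le_of_isODESolution hfω hgω (hω.abs_le_slopeBound hl hfω)
      (hω.abs_le_slopeBound le_rfl hgω) hl hx h0
  · filter_upwards [h1] with ω hω using not_le.1 hω

theorem ae_le_total [IsProbabilityMeasure P] (h : IsRandomCoercivePair P τ α β a H)
    {lam mu : ℝ} {f g : ℝ → Ω → ℝ} (hf : f ∈ stationarySolutions P τ a H lam)
    (hg : g ∈ stationarySolutions P τ a H mu) :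
    (∀ᵐ ω ∂P, f 0 ω ≤ g 0 ω) ∨ ∀ᵐ ω ∂P, g 0 ω ≤ f 0 ω := by
  rcases le_total lam mu with hl | hl
  · exact (h.ae_le_or_ae_lt hl hf hg).imp id fun h1 => h1.mono fun _ hω => hω.le
  · exact (h.ae_le_or_ae_lt hl hg hf).symm.imp (fun h1 => h1.mono fun _ hω => hω.le) id

/-- Stationary solutions with the same mean solve the equation at the same level. -/
theorem level_eq_of_mem_thetaMap [IsProbabilityMeasure P] (h : IsRandomCoercivePair P τ α β a H)
    {lam mu θ : ℝ} (h1 : θ ∈ thetaMap P τ a H lam) (h2 : θ ∈ thetaMap P τ a H mu) : lam = mu := by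
  obtain ⟨f, hf, hfθ⟩ := h1
  obtain ⟨g, hg, hgθ⟩ := h2
  have hint : ∫ ω, f 0 ω ∂P = ∫ ω, g 0 ω ∂P := hfθ.symm.trans hgθ
  have hae : f 0 =ᵐ[P] g 0 := by
    rcases h.ae_le_total hf hg with hle | hle
    · exact (integral_eq_iff_of_ae_le (integrable_of_mem hf) (integrable_of_mem hg) hle).1 hint
    · exact ((integral_eq_iff_of_ae_le (integrable_of_mem hg) (integrable_of_mem hf) hle).1
        hint.symm).symm
  have hle := hf.1.ae_forall_le h.action hg.1 (ae_continuous hf) (ae_continuous hg) hae.le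
  have hge := hg.1.ae_forall_le h.action hf.1 (ae_continuous hg) (ae_continuous hf) hae.symm.le
  obtain ⟨ω, h1, h2, h3, h4⟩ := (hle.and (hge.and (hf.2.2.and hg.2.2))).exists
  have e : (fun x => f x ω) = fun x => g x ω := funext fun x => le_antisymm (h1 x) (h2 x)
  rw [e] at h3
  exact (h3.2 0).symm.trans (h4.2 0)

/-- Almost sure pointwise limits of stationary solutions are stationary solutions, and their means
converge. -/
theorem mem_thetaMap_of_ae_tendsto [IsProbabilityMeasure P]
    (h : IsRandomCoercivePair P τ α β a H) {l : ℕ → ℝ} {lam θ : ℝ}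
    (hl : Tendsto l atTop (𝓝 lam)) {f : ℕ → ℝ → Ω → ℝ}
    (hf : ∀ n, f n ∈ stationarySolutions P τ a H (l n))
    (hθ : Tendsto (fun n => ∫ ω, f n 0 ω ∂P) atTop (𝓝 θ))
    (hconv : ∀ᵐ ω ∂P, ∀ x, ∃ c, Tendsto (fun n => f n x ω) atTop (𝓝 c)) :
    θ ∈ thetaMap P τ a H lam := by
  obtain ⟨Λ, hΛ⟩ := hl.bddAbove_range
  have hΛ : ∀ n, l n ≤ Λ := fun n => hΛ ⟨n, rfl⟩
  set F : ℝ → Ω → ℝ := fun x ω => limsup (fun n => f n x ω) atTop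
  have hFlim : ∀ᵐ ω ∂P, ∀ x, Tendsto (fun n => f n x ω) atTop (𝓝 (F x ω)) := by
    filter_upwards [hconv] with ω hω x
    obtain ⟨c, hc⟩ := hω x
    rwa [← hc.limsup_eq] at hc
  have hb : ∀ᵐ ω ∂P, ∀ n x, |f n x ω| ≤ slopeBound α β Λ :=
    ae_all_iff.2 fun n => h.ae_abs_le_slopeBound (hΛ n) (hf n)
  have hmem : F ∈ stationarySolutions P τ a H lam := by
    refine ⟨IsStationaryFun.limsup fun n => (hf n).1, ⟨slopeBound α β Λ, ?_⟩, ?_⟩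
    · filter_upwards [hFlim, hb] with ω h1 h2 x
      exact le_of_tendsto (h1 x).abs (Eventually.of_forall fun n => h2 n x)
    · filter_upwards [h.pair, hFlim, hb, ae_all_iff.2 fun n => (hf n).2.2] with ω hω h1 h2 h3
      exact hω.isODESolution_of_tendsto (by linarith [hω.slopeBound_ge_one Λ]) hl
        (fun R => Eventually.of_forall fun n x _ => ⟨h2 n x, hω.isODESolution_iff.1 (h3 n) x⟩) h1
  refine ⟨F, hmem, tendsto_nhds_unique hθ ?_⟩
  apply tendsto_integral_of_dominated_convergence (fun _ => slopeBound α β Λ)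
  · exact fun n => ((hf n).1.measurable_apply 0).aestronglyMeasurable
  · exact integrable_const _
  · exact fun n => hb.mono fun ω hω => hω n 0
  · exact hFlim.mono fun ω hω => hω 0

/-- The almost sure order is total on stationary solutions, so a Ramsey argument extracts a monotone
subsequence. Being bounded, it converges at every point for almost every `ω`; order plays the role
of compactness. -/
theorem mem_thetaMap_of_tendsto [IsProbabilityMeasure P] (h : IsRandomCoercivePair P τ α β a H)
    {l t : ℕ → ℝ} {lam θ : ℝ} (hl : Tendsto l atTop (𝓝 lam)) (ht : Tendsto t atTop (𝓝 θ))
    (hmem : ∀ n, t n ∈ thetaMap P τ a H (l n)) : θ ∈ thetaMap P τ a H lam := by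
  choose f hf hft using hmem
  obtain ⟨Λ, hΛ⟩ := hl.bddAbove_range
  have hΛ : ∀ n, l n ≤ Λ := fun n => hΛ ⟨n, rfl⟩
  have hb : ∀ᵐ ω ∂P, ∀ n x, |f n x ω| ≤ slopeBound α β Λ :=
    ae_all_iff.2 fun n => h.ae_abs_le_slopeBound (hΛ n) (hf n)
  let r : (ℝ → Ω → ℝ) → (ℝ → Ω → ℝ) → Prop := fun u w => ∀ᵐ ω ∂P, u 0 ω ≤ w 0 ω
  have : IsTrans _ r := ⟨fun u v w h1 h2 => by
    filter_upwards [h1, h2] with ω h3 h4 using h3.trans h4⟩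
  obtain ⟨φ, hφ⟩ := exists_increasing_or_nonincreasing_subseq r f
  have hφt : Tendsto φ atTop atTop := φ.strictMono.tendsto_atTop
  have hall : ∀ m n, r (f m) (f n) → ∀ᵐ ω ∂P, ∀ x, f m x ω ≤ f n x ω := fun m n hr =>
    (hf m).1.ae_forall_le h.action (hf n).1 (ae_continuous (hf m)) (ae_continuous (hf n)) hr
  refine h.mem_thetaMap_of_ae_tendsto (hl.comp hφt) (f := fun n => f (φ n)) (fun n => hf _) ?_ ?_
  · simpa only [Function.comp_def, hft] using ht.comp hφt
  · rcases hφ with hinc | hdec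
    · have h1 : ∀ᵐ ω ∂P, ∀ n x, f (φ n) x ω ≤ f (φ (n + 1)) x ω :=
        ae_all_iff.2 fun n => hall _ _ (hinc n (n + 1) n.lt_succ_self)
      filter_upwards [h1, hb] with ω h2 h3 x
      refine ⟨_, tendsto_atTop_ciSup (monotone_nat_of_le_succ fun n => h2 n x)
        ⟨slopeBound α β Λ, ?_⟩⟩
      rintro _ ⟨n, rfl⟩
      exact (abs_le.1 (h3 _ x)).2
    -- Here the subsequence only fails to increase; totality of the order turns this into a
    -- decrease.
    · have h1 : ∀ᵐ ω ∂P, ∀ n x, f (φ (n + 1)) x ω ≤ f (φ n) x ω :=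
        ae_all_iff.2 fun n => hall _ _
          ((h.ae_le_total (hf _) (hf _)).resolve_left (hdec n (n + 1) n.lt_succ_self))
      filter_upwards [h1, hb] with ω h2 h3 x
      refine ⟨_, tendsto_atTop_ciInf (antitone_nat_of_succ_le fun n => h2 n x)
        ⟨-slopeBound α β Λ, ?_⟩⟩
      rintro _ ⟨n, rfl⟩
      exact (abs_le.1 (h3 _ x)).1

theorem isCompact_biUnion_thetaMap [IsProbabilityMeasure P]
    (h : IsRandomCoercivePair P τ α β a H) {K : Set ℝ} (hK : IsCompact K) :
    IsCompact (⋃ lam ∈ K, thetaMap P τ a H lam) := by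
  obtain ⟨Λ, hΛ⟩ := hK.bddAbove
  refine Metric.isCompact_of_isClosed_isBounded ?_ ?_
  · refine IsSeqClosed.isClosed fun t θ ht hlim => ?_
    simp only [mem_iUnion₂] at ht
    choose l hlK hl using ht
    obtain ⟨lam, hlam, φ, hφ, hφl⟩ := hK.tendsto_subseq hlK
    exact mem_iUnion₂.2 ⟨lam, hlam,
      h.mem_thetaMap_of_tendsto hφl (hlim.comp hφ.tendsto_atTop) fun n => hl (φ n)⟩
  · refine (Metric.isBounded_closedBall (x := (0 : ℝ)) (r := slopeBound α β Λ)).subset ?_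
    intro θ hθ
    obtain ⟨lam, hlam, hθ⟩ := mem_iUnion₂.1 hθ
    rw [mem_closedBall_zero_iff, Real.norm_eq_abs]
    exact h.abs_le_of_mem_thetaMap (hΛ hlam) hθ

theorem isCompact_thetaMap [IsProbabilityMeasure P] (h : IsRandomCoercivePair P τ α β a H)
    (lam : ℝ) : IsCompact (thetaMap P τ a H lam) := by
  simpa using h.isCompact_biUnion_thetaMap (isCompact_singleton (x := lam))

/-- Means that escape `U` at levels tending to `lam` are bounded, so a subsequence converges; its
limit lies in `Θ(lam)` by closedness of the graph and outside `U` as `U` is open. -/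
theorem upperHemicontinuousOn_thetaMap [IsProbabilityMeasure P]
    (h : IsRandomCoercivePair P τ α β a H) (s : Set ℝ) :
    UpperHemicontinuousOn (thetaMap P τ a H) s := by
  rw [upperHemicontinuousOn_iff_forall_isOpen]
  intro lam _ U hU hsub
  by_contra hfr
  have hfr' : ∃ᶠ mu in 𝓝 lam, ¬ thetaMap P τ a H mu ⊆ U :=
    (not_eventually.1 hfr).filter_mono nhdsWithin_le_nhds
  obtain ⟨l, hl, hlU⟩ := exists_seq_forall_of_frequently hfr'
  simp only [not_subset] at hlU
  choose t ht htU using hlU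
  obtain ⟨Λ, hΛ⟩ := hl.bddAbove_range
  obtain ⟨θ, -, φ, hφ, hφt⟩ := (isCompact_closedBall (0 : ℝ) (slopeBound α β Λ)).tendsto_subseq
    (x := t) fun n => by
      rw [mem_closedBall_zero_iff, Real.norm_eq_abs]
      exact h.abs_le_of_mem_thetaMap (hΛ ⟨n, rfl⟩) (ht n)
  have hθ := h.mem_thetaMap_of_tendsto (hl.comp hφ.tendsto_atTop) hφt fun n => ht (φ n)
  exact hU.isClosed_compl.mem_of_tendsto hφt (Eventually.of_forall fun n => htU (φ n)) (hsub hθ)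

theorem tendsto_sSup_thetaMap [IsProbabilityMeasure P] (h : IsRandomCoercivePair P τ α β a H) :
    Tendsto (fun lam => sSup (thetaMap P τ a H lam)) atTop atTop := by
  refine tendsto_atTop.2 fun M => ?_
  obtain ⟨Λ, hΛ⟩ := h.exists_large_mem_thetaMap M
  filter_upwards [eventually_ge_atTop Λ] with lam hlam
  obtain ⟨θ, hθ, hM⟩ := hΛ lam hlam
  exact hM.trans (le_csSup (h.isCompact_thetaMap lam).bddAbove hθ)

theorem tendsto_sInf_thetaMap [IsProbabilityMeasure P] (h : IsRandomCoercivePair P τ α β a H) :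
    Tendsto (fun lam => sInf (thetaMap P τ a H lam)) atTop atBot := by
  refine tendsto_atBot.2 fun M => ?_
  obtain ⟨Λ, hΛ⟩ := h.neg.exists_large_mem_thetaMap (-M)
  filter_upwards [eventually_ge_atTop Λ] with lam hlam
  obtain ⟨θ, hθ, hM⟩ := hΛ lam hlam
  exact (csInf_le (h.isCompact_thetaMap lam).bddBelow (neg_mem_thetaMap hθ)).trans (by linarith)

end IsRandomCoercivePair

/-! ### Verification of the structural assumptions and conclusion -/

theorem IsHamiltonian.continuous_uncurry {Ω : Type*} {α₀ α₁ γ : ℝ} {H : ℝ → ℝ → Ω → ℝ}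
    (hH : IsHamiltonian α₀ α₁ γ H) (hγ : 1 ≤ γ) (ω : Ω) :
    Continuous (Function.uncurry fun x p => H x p ω) := by
  rw [continuous_iff_continuousAt]
  rintro ⟨x₀, p₀⟩
  rw [ContinuousAt, tendsto_iff_dist_tendsto_zero]
  have hbd : Continuous fun z : ℝ × ℝ => α₁ * (|z.2| ^ γ + 1) * |z.1 - x₀|
      + α₁ * (|z.2| + |p₀| + 1) ^ (γ - 1) * |z.2 - p₀| := by
    have h1 : Continuous fun z : ℝ × ℝ => |z.2| ^ γ :=
      continuous_snd.abs.rpow_const fun _ => Or.inr (by linarith)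
    have h2 : Continuous fun z : ℝ × ℝ => (|z.2| + |p₀| + 1) ^ (γ - 1) :=
      Continuous.rpow_const (by fun_prop) fun _ => Or.inr (by linarith)
    fun_prop
  have hlim := hbd.tendsto (x₀, p₀)
  simp only [sub_self, abs_zero, mul_zero, add_zero] at hlim
  refine squeeze_zero (fun _ => dist_nonneg) (fun z => ?_) hlim
  rw [Real.dist_eq]
  calc _ = |(H z.1 z.2 ω - H x₀ z.2 ω) + (H x₀ z.2 ω - H x₀ p₀ ω)| := by
        simp [Function.uncurry]
    _ ≤ _ := (abs_add_le _ _).trans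
      (add_le_add (hH.lipschitz_x _ _ _ _) (hH.lipschitz_p _ _ _ _))

/-- Since `γ > 2`, `|p| ^ γ ≥ p ^ 2 - 1`. Quadratic coercivity is all that the barrier argument
uses, and replacing the power costs `α₀` in the additive constant. -/
theorem IsHamiltonian.isCoercivePair {Ω : Type*} {α₀ α₁ γ : ℝ} {H : ℝ → ℝ → Ω → ℝ}
    (hH : IsHamiltonian α₀ α₁ γ H) (hα₀ : 0 < α₀) (hα₁ : 0 < α₁) (hγ : 2 < γ) {b : ℝ → ℝ}
    (hbc : Continuous b) (hb0 : ∀ x, 0 < b x) (hb1 : ∀ x, b x ≤ 1) (ω : Ω) :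
    IsCoercivePair α₀ (α₀ + 1 / α₀) b fun x p => H x p ω where
  pos := hα₀
  continuous_left := hbc
  left_pos := hb0
  left_le_one := hb1
  continuous_right := hH.continuous_uncurry (by linarith) ω
  lipschitz R := by
    refine ⟨α₁ * (2 * |R| + 1) ^ (γ - 1), by positivity, fun x p q hp hq => ?_⟩
    refine (hH.lipschitz_p x p q ω).trans ?_
    have := le_abs_self R
    gcongr
    · linarith
    · linarith
  lower x p := by
    have h1 : p ^ 2 ≤ |p| ^ γ + 1 := by
      rcases le_total |p| 1 with hp | hp
      · have : 0 ≤ |p| ^ γ := by positivity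
        have := (sq_le_one_iff_abs_le_one p).2 hp
        linarith
      · have := Real.rpow_le_rpow_of_exponent_le hp hγ.le
        rw [Real.rpow_two, sq_abs] at this
        linarith
    have h2 := hH.lower x p ω
    nlinarith

theorem IsDiffusionCoeff.continuous {Ω : Type*} [MeasurableSpace Ω] {P : Measure Ω}
    {τ : ℝ → Ω → Ω} {κ : ℝ} {a : ℝ → Ω → ℝ} (ha : IsDiffusionCoeff P τ κ a) (hκ : 0 ≤ κ) (ω : Ω) :
    Continuous fun x => a x ω := by
  have hlip : LipschitzWith ⟨κ, hκ⟩ fun x => √(a x ω) :=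
    LipschitzWith.of_dist_le_mul fun x y => ha.sqrt_lipschitz ω x y
  have e : (fun x => a x ω) = fun x => √(a x ω) ^ 2 :=
    funext fun x => (Real.sq_sqrt (ha.mem_Icc x ω).1).symm
  rw [e]
  exact hlip.continuous.pow 2

theorem proposition5p1 {Ω : Type*} [MeasurableSpace Ω] (P : Measure Ω) [IsProbabilityMeasure P]
    (τ : ℝ → Ω → Ω) (hτ : IsErgodicAction P τ)
    (κ : ℝ) (hκ : 0 < κ) (a : ℝ → Ω → ℝ) (ha : IsDiffusionCoeff P τ κ a)
    (α₀ α₁ γ : ℝ) (hα₀ : 0 < α₀) (hα₁ : 0 < α₁) (hγ : 2 < γ)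
    (H : ℝ → ℝ → Ω → ℝ) (hH : IsHamiltonian α₀ α₁ γ H) (hHs : IsStationaryHamiltonian τ H) :
    -- the critical value is almost surely a (finite) constant `lam₀`
    ∃ lam₀ : ℝ,
      (∀ᵐ ω ∂P, IsGLB (supersolutionLevels (fun x => a x ω) (fun x p => H x p ω)) lam₀) ∧
      -- (i) nonempty compact values
      (∀ lam ∈ Set.Ici lam₀,
        (thetaMap P τ a H lam).Nonempty ∧ IsCompact (thetaMap P τ a H lam)) ∧
      -- (ii) local equi-compactness
      LocallyEquiCompactOn (thetaMap P τ a H) (Set.Ici lam₀) ∧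
      -- (iii) upper semicontinuity, through neighbourhoods and through sequences
      (UpperHemicontinuousOn (thetaMap P τ a H) (Set.Ici lam₀) ∧
        HasSeqClosedGraphOn (thetaMap P τ a H) (Set.Ici lam₀)) ∧
      -- (iv) values at distinct levels are disjoint
      (∀ lam₁ ∈ Set.Ici lam₀, ∀ lam₂ ∈ Set.Ici lam₀, lam₁ ≠ lam₂ →
        thetaMap P τ a H lam₁ ∩ thetaMap P τ a H lam₂ = ∅) ∧
      -- (v) `max Θ` tends to `+∞` and `min Θ` tends to `-∞` as the level tends to `+∞`
      Tendsto (fun lam => sSup (thetaMap P τ a H lam)) atTop atTop ∧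
      Tendsto (fun lam => sInf (thetaMap P τ a H lam)) atTop atBot := by
  have h : IsRandomCoercivePair P τ α₀ (α₀ + 1 / α₀) a H :=
    { action := hτ
      stationary_left := ha.stationary
      stationary_right := hHs
      pair := by
        filter_upwards [ha.pos] with ω hω
        exact hH.isCoercivePair hα₀ hα₁ hγ (ha.continuous hκ.le ω) hω
          (fun x => (ha.mem_Icc x ω).2) ω
      bounded := fun M => ⟨_, fun x ω => hH.upper x M ω⟩ }
  refine ⟨sInf (IsRandomCoercivePair.solvableLevels P a H), h.ae_isGLB_supersolutionLevels,
    fun lam hlam => ⟨h.thetaMap_nonempty (h.mem_solvableLevels_iff.2 hlam),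
      h.isCompact_thetaMap lam⟩,
    fun K _ hK => h.isCompact_biUnion_thetaMap hK,
    ⟨h.upperHemicontinuousOn_thetaMap _,
      fun l t l₀ t₀ _ _ ht hl hlim => h.mem_thetaMap_of_tendsto hl hlim ht⟩,
    fun lam₁ _ lam₂ _ hne => ?_, h.tendsto_sSup_thetaMap, h.tendsto_sInf_thetaMap⟩
  rw [eq_empty_iff_forall_notMem]
  exact fun θ hθ => hne (h.level_eq_of_mem_thetaMap hθ.1 hθ.2)
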